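/- Let $(\Omega,\mathcal F,\mathbb P)$ be a probability space and let $R_i$, $i\in\mathbb Z$, follow the functional stochastic volatility model $$R_i(t)=g_i\int_0^t\sigma(u)\,dW_i(u),\quad t\in[0,1],\qquad \log g_i=\varphi\log g_{i-1}+\varepsilon_i,\qquad i\in\mathbb Z,$$ where the $\varepsilon_i$ are i.i.d. and nondegenerate, with mean zero and finite variance $\sigma_\varepsilon^2>0$, the stochastic integrals are Itô integrals, and $(g_i)_{i\in\mathbb Z}$ is strictly stationary. Assume that 1. $\sigma$ is a deterministic Borel function that is nonnegative and bounded on $[0,1]$; 2. each $g_i$ is positive almost surely; 3. the $W_i$ are independent standard Brownian motions; 4. the sequences $\{W_i\}$ and $\{g_i\}$ are independent; 5. $|\varphi|<1$; 6. $\sigma(t)\neq0$ for Lebesgue-almost every $t\in[0,1]$. Put $G(t)=\int_0^t\sigma^2(u)\,du$ and $H(t)=\log G(t)$. Given the observations $R_i(t_k)$, $1\le i\le N$, $0\le k\le m$, at $t_k=k\Delta$ with $\Delta=1/m$, put $$\widehat Q_i(t)=\sum_{k=1}^m|R_i(t_k)-R_i(t_{k-1})|^2\,\mathbb I\{t_k\le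 t\},\qquad \widehat H(t)=\frac1N\sum_{i=1}^N\log\widehat Q_i(t),\qquad \widehat G(t)=\exp\widehat H(t).$$ Then, for every fixed $\alpha\in(0,1)$, as $N\to\infty$ and $\Delta\to0$ jointly, with no relation imposed between $N$ and $\Delta$, $$\mathbb E\sup_{t\in[\alpha,1]}\bigl|\widehat H(t)-H(t)\bigr|=O\bigl(N^{-1/2}+\Delta^{1/2}\bigr),\qquad \sup_{t\in[\alpha,1]}\bigl|\widehat G(t)-G(t)\bigr|=O_P\bigl(N^{-1/2}+\Delta^{1/2}\bigr).$$ -/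

import Mathlib

open MeasureTheory ProbabilityTheory Filter Topology Set
open scoped NNReal ENNReal

noncomputable section

namespace FSV

variable {Ω : Type*} [MeasurableSpace Ω]

/-! ### The Itô integral of a deterministic square integrable function -/

/-- A deterministic step function on `[0, ∞)`: value `c j` on `(s j, s (j + 1)]` for `j < n`,
and `0` elsewhere. -/
structure StepFunction where
  n : ℕ
  s : ℕ → ℝ≥0
  c : ℕ → ℝ
  mono : Monotone s

/-- The value of the step function at `u`. -/
def StepFunction.eval (f : StepFunction) (u : ℝ) : ℝ :=
  ∑ j ∈ Finset.range f.n, if (f.s j : ℝ) < u ∧ u ≤ (f.s (j + 1) : ℝ) then f.c j else 0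

/-- The elementary stochastic integral of a step function with respect to `B`. -/
def StepFunction.stochInt (f : StepFunction) (B : ℝ≥0 → Ω → ℝ) (ω : Ω) : ℝ :=
  ∑ j ∈ Finset.range f.n, f.c j * (B (f.s (j + 1)) ω - B (f.s j) ω)

/-- `I` is (a version of) the Itô integral `∫₀ᵗ h(u) dB(u)` of the deterministic function `h`:
it is the limit in `L²(P)` of the elementary integrals of a sequence of step functions that
converges to `h` in `L²([0, t])`. By the Itô isometry this determines `I` almost surely. -/
def IsItoIntegral (P : Measure Ω) (B : ℝ≥0 → Ω → ℝ) (h : ℝ → ℝ) (t : ℝ≥0) (I : Ω → ℝ) : Prop :=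
  MemLp I 2 P ∧
  ∃ f : ℕ → StepFunction,
    (∀ k j, (f k).s j ≤ t) ∧
    Tendsto (fun k => ∫⁻ u in Icc (0 : ℝ) t, ENNReal.ofReal ((h u - (f k).eval u) ^ 2))
      atTop (𝓝 0) ∧
    Tendsto (fun k => eLpNorm (fun ω => I ω - (f k).stochInt B ω) 2 P) atTop (𝓝 0)

/-! ### The functional stochastic volatility model -/

/-- The equations of the functional stochastic volatility model, with `(g i)` the strictly
stationary solution of the log-AR(1) recursion and `(ε i)` i.i.d. nondegenerate with mean zero and
variance `v`:
`R i t = g i * ∫₀ᵗ σ(u) dW i(u)` for `t ∈ [0, 1]`, and `log (g i) = φ * log (g (i - 1)) + ε i`. -/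
structure IsModel (P : Measure Ω) (σ : ℝ → ℝ) (φ v : ℝ) (W : ℤ → ℝ≥0 → Ω → ℝ)
    (ε g : ℤ → Ω → ℝ) (R : ℤ → ℝ≥0 → Ω → ℝ) : Prop where
  eq_R : ∀ i : ℤ, ∀ t : ℝ≥0, t ≤ 1 →
    ∃ I : Ω → ℝ, IsItoIntegral P (W i) σ t I ∧ ∀ᵐ ω ∂P, R i t ω = g i ω * I ω
  eq_g : ∀ i : ℤ, ∀ᵐ ω ∂P, Real.log (g i ω) = φ * Real.log (g (i - 1) ω) + ε i ω
  stationary : ∀ h : ℤ, IdentDistrib (fun ω (i : ℤ) => g (i + h) ω) (fun ω (i : ℤ) => g i ω) P P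
  noise_indep : iIndepFun ε P
  noise_identDistrib : ∀ i : ℤ, IdentDistrib (ε i) (ε 0) P P
  noise_memLp : MemLp (ε 0) 2 P
  noise_mean : ∫ ω, ε 0 ω ∂P = 0
  noise_variance : ProbabilityTheory.variance (ε 0) P = v
  noise_nondegenerate : 0 < v

/-- The cumulative volatility `G(t) = ∫₀ᵗ σ²(u) du`. -/
def G (σ : ℝ → ℝ) (t : ℝ) : ℝ := ∫ u in (0 : ℝ)..t, σ u ^ 2

/-- The log cumulative volatility `H(t) = log G(t)`. -/
def H (σ : ℝ → ℝ) (t : ℝ) : ℝ := Real.log (G σ t)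

/-! ### The estimators, from the observations `R i (k / m)`, `i = 1, …, N`, `k = 0, …, m` -/

/-- The design point `t_k = k Δ`, with `Δ = 1 / m`. -/
def gridPt (m k : ℕ) : ℝ≥0 := (k : ℝ≥0) / (m : ℝ≥0)

/-- The realized quadratic variation: the sum over `k = 1, …, m` with `t_k ≤ t` of
`|R i (t_k) - R i (t_{k-1})|²` (the sum below runs over `k - 1`). -/
def Qhat (R : ℤ → ℝ≥0 → Ω → ℝ) (m : ℕ) (i : ℤ) (t : ℝ) (ω : Ω) : ℝ :=
  ∑ k ∈ Finset.range m,
    if (gridPt m (k + 1) : ℝ) ≤ t then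
      |R i (gridPt m (k + 1)) ω - R i (gridPt m k) ω| ^ 2
    else 0

/-- `Ĥ(t) = N⁻¹ ∑_{i=1}^N log Q̂_i(t)`. -/
def Hhat (R : ℤ → ℝ≥0 → Ω → ℝ) (N m : ℕ) (t : ℝ) (ω : Ω) : ℝ :=
  (1 / (N : ℝ)) * ∑ i ∈ Finset.Icc 1 N, Real.log (Qhat R m (i : ℤ) t ω)

/-- `Ĝ(t) = exp (Ĥ(t))`. -/
def Ghat (R : ℤ → ℝ≥0 → Ω → ℝ) (N m : ℕ) (t : ℝ) (ω : Ω) : ℝ :=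
  Real.exp (Hhat R N m t ω)

/-- `N^{-1/2} + Δ^{1/2}` with `Δ = 1 / m`. -/
def rate (N m : ℕ) : ℝ := (N : ℝ) ^ (-(1 / 2) : ℝ) + (1 / (m : ℝ)) ^ (1 / 2 : ℝ)

/-! ### Orders of magnitude as `N → ∞` and `m → ∞` (that is, `Δ → 0`) jointly, without any
relation between `N` and `m` -/

/-- `E X_{N,m} = O(r_{N,m})`, for `[0, ∞]`-valued random variables `X_{N,m}`. -/
def MeanIsBigO (P : Measure Ω) (X : ℕ → ℕ → Ω → ℝ≥0∞) (r : ℕ → ℕ → ℝ) : Prop :=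
  ∃ C : ℝ, ∀ᶠ p : ℕ × ℕ in atTop ×ˢ atTop,
    ∫⁻ ω, X p.1 p.2 ω ∂P ≤ ENNReal.ofReal (C * r p.1 p.2)

/-- `X_{N,m} = O_P(r_{N,m})`, for `[0, ∞]`-valued random variables `X_{N,m}`. -/
def IsBigOInProb (P : Measure Ω) (X : ℕ → ℕ → Ω → ℝ≥0∞) (r : ℕ → ℕ → ℝ) : Prop :=
  ∀ δ : ℝ, 0 < δ → ∃ M : ℝ, ∀ᶠ p : ℕ × ℕ in atTop ×ˢ atTop,
    P {ω | ENNReal.ofReal (M * r p.1 p.2) < X p.1 p.2 ω} ≤ ENNReal.ofReal δ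

end FSV

end

/-!
The factor `g i` of the returns enters `log Q̂ i t` only through the additive term `2 log (g i)`, so

`Ĥ t - H t = (2 / N) ∑ i, log (g i) + (1 / N) ∑ i, (log (S i t) - H t)`,

where `S i t` is the realized volatility of the Itô integral `∫ σ dW i`, which does not involve
`g i`. Each of the two averages is bounded in mean, and for the second one the triangle inequality
is enough: it suffices to bound `E sup_t |log (S i t) - H t|` for a single `i`.

*The volatility factors.* Summing the recursion `X i = φ X (i - 1) + ε i` over `1 ≤ i ≤ N` gives
`(1 - φ) ∑ X i = φ (X 0 - X N) + ∑ ε i`, which is of order `√N` in `L¹` as soon as `X 0` is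
integrable (`exists_integral_abs_sum_autoregression_le`). Integrability follows by unrolling the
recursion: `X 0 = φ ^ n X (-n) + Y` with `Y` bounded in `L¹`, and by stationarity the first term
tends to zero in probability (`integrable_of_stationary_autoregression`).

*Law of the Itô integral.* Square integrable Gaussian variables are closed in `L²`, so the Itô
integral of a deterministic function is a centered Gaussian process whose covariance is given by
the Itô isometry (`FSV.IsItoIntegral.isGaussianProcess`). Its increments over the grid are therefore
independent Gaussian variables with variances `G t_{k+1} - G t_k`.

*Realized volatility.* `S i t_n - G t_n` is a sum of `n` independent centered variables with
variances of order `Δ²`, so that its running maximum is of order `Δ^{1/2}` in `L²` by Doob's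
inequality, which is obtained from a pathwise inequality (`sq_partialSups_le`). To pass to
logarithms, a deviation at most `G α / 2` is handled by the mean value theorem. A larger deviation
`Y` satisfies `1 ≤ Y / (G α / 2)`, so it is enough that `log (S i α)` and `log (S i 1)` are bounded
in `L²` (`abs_log_sub_log_le`). This follows from the concavity of the logarithm, which compares
the logarithm of a weighted sum of squares with the weighted sum of the logarithms, and from the
square integrability of `log` for the Gaussian law (`eLpNorm_log_sum_sq_le`). The product of the
two `L²` bounds is the estimate `FSV.IsVolatility.exists_majorant`.

The statement for `Ĝ = exp Ĥ` follows from that for `Ĥ` by Markov's inequality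
(`FSV.orders_of_majorant`).
-/

/-! ### Gaussian laws are closed in `L²` -/

namespace MeasureTheory.Lp

variable {Ω : Type*} [MeasurableSpace Ω] {P : Measure Ω}

lemma integral_mul_eq_inner (x y : Lp ℝ 2 P) : ∫ ω, x ω * y ω ∂P = inner ℝ x y := by
  rw [L2.inner_def]
  refine integral_congr_ae (Eventually.of_forall fun ω => ?_)
  simp [mul_comm]

variable [IsProbabilityMeasure P]

lemma integrable_two (x : Lp ℝ 2 P) : Integrable x P :=
  (Lp.memLp x).integrable (by norm_num)

lemma integral_abs_le_norm_two (x : Lp ℝ 2 P) : ∫ ω, |x ω| ∂P ≤ ‖x‖ := by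
  have h1 : ∫ ω, |x ω| ∂P = (eLpNorm x 1 P).toReal := by
    rw [eLpNorm_one_eq_lintegral_enorm,
      ← integral_norm_eq_lintegral_enorm (Lp.memLp x).aestronglyMeasurable]
    rfl
  rw [h1, Lp.norm_def]
  exact ENNReal.toReal_mono (Lp.eLpNorm_ne_top x)
    (eLpNorm_le_eLpNorm_of_exponent_le (by norm_num) (Lp.memLp x).aestronglyMeasurable)

lemma continuous_integral_two : Continuous fun x : Lp ℝ 2 P => ∫ ω, x ω ∂P := by
  refine (LipschitzWith.of_dist_le_mul (K := 1) fun x y => ?_).continuous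
  rw [Real.dist_eq, dist_eq_norm_sub x y, NNReal.coe_one, one_mul,
    ← integral_sub (integrable_two x) (integrable_two y)]
  refine le_trans (abs_integral_le_integral_abs) (le_trans (le_of_eq ?_)
    (integral_abs_le_norm_two (x - y)))
  refine integral_congr_ae ?_
  filter_upwards [Lp.coeFn_sub x y] with ω h
  rw [h]; rfl

lemma continuous_charFun_two (t : ℝ) :
    Continuous fun x : Lp ℝ 2 P => charFun (P.map x) t := by
  refine (LipschitzWith.of_dist_le_mul (K := ‖t‖₊) fun x y => ?_).continuous
  have hm : ∀ z : Lp ℝ 2 P, AEMeasurable z P := fun z => (Lp.aestronglyMeasurable z).aemeasurable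
  have hcm : ∀ z : Lp ℝ 2 P, AEStronglyMeasurable (fun ω => Complex.exp (t * z ω * Complex.I)) P :=
    fun z => by
      have := hm z
      exact AEMeasurable.aestronglyMeasurable (by fun_prop)
  have hn : ∀ z : ℝ, ‖Complex.exp (t * z * Complex.I)‖ = 1 := fun z => by
    rw [← Complex.ofReal_mul, Complex.norm_exp_ofReal_mul_I]
  have hi : ∀ z : Lp ℝ 2 P, Integrable (fun ω => Complex.exp (t * z ω * Complex.I)) P := fun z =>
    (integrable_const (1 : ℝ)).mono' (hcm z) (Eventually.of_forall fun ω => (hn _).le)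
  have hchar : ∀ z : Lp ℝ 2 P, charFun (P.map z) t = ∫ ω, Complex.exp (t * z ω * Complex.I) ∂P :=
    fun z => by
      rw [charFun_apply_real, integral_map (hm z) (by fun_prop)]
  rw [dist_eq_norm_sub, dist_eq_norm_sub x y, hchar, hchar, ← integral_sub (hi x) (hi y)]
  have hb : ∀ a b : ℝ, ‖Complex.exp (t * a * Complex.I) - Complex.exp (t * b * Complex.I)‖
      ≤ ‖t‖ * |a - b| := fun a b => by
    have : Complex.exp (t * a * Complex.I) - Complex.exp (t * b * Complex.I)
        = Complex.exp (t * b * Complex.I) *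
          (Complex.exp (Complex.I * ((t * (a - b) : ℝ) : ℂ)) - 1) := by
      rw [mul_sub, ← Complex.exp_add, mul_one]
      congr 2
      push_cast; ring
    rw [this, norm_mul, hn, one_mul]
    refine Real.norm_exp_I_mul_ofReal_sub_one_le.trans ?_
    rw [norm_mul, Real.norm_eq_abs (a - b)]
  refine (norm_integral_le_integral_norm _).trans ?_
  have hxy := integrable_two (x - y)
  calc ∫ ω, ‖Complex.exp (t * x ω * Complex.I) - Complex.exp (t * y ω * Complex.I)‖ ∂P
      ≤ ∫ ω, ‖t‖ * |(x - y : Lp ℝ 2 P) ω| ∂P := by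
        refine integral_mono_ae ((hi x).sub (hi y)).norm (hxy.abs.const_mul _) ?_
        filter_upwards [Lp.coeFn_sub x y] with ω h
        rw [h]
        exact hb _ _
    _ ≤ ‖t‖ * ‖x - y‖ := by
        rw [integral_const_mul]
        exact mul_le_mul_of_nonneg_left (integral_abs_le_norm_two _) (norm_nonneg _)

lemma continuous_variance_two : Continuous fun x : Lp ℝ 2 P => Var[x; P] := by
  have : (fun x : Lp ℝ 2 P => Var[x; P]) = fun x => inner ℝ x x - (∫ ω, x ω ∂P) ^ 2 := by
    funext x
    rw [variance_eq_sub (Lp.memLp x), ← integral_mul_eq_inner]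
    simp [pow_two]
  rw [this]
  exact (continuous_id.inner continuous_id).sub (continuous_integral_two.pow 2)

/-- Gaussian random variables form a closed subset of `L²`: the characteristic function, the mean
and the variance are continuous on `L²`. -/
lemma isClosed_hasGaussianLaw : IsClosed {x : Lp ℝ 2 P | HasGaussianLaw x P} := by
  have : {x : Lp ℝ 2 P | HasGaussianLaw x P} = ⋂ t : ℝ, {x : Lp ℝ 2 P | charFun (P.map x) t =
      Complex.exp ((t * ∫ ω, x ω ∂P : ℝ) * Complex.I - (t ^ 2 * Var[x; P] : ℝ) / 2)} := by
    ext x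
    simp only [mem_ofPred_eq, mem_iInter]
    rw [hasGaussianLaw_iff_charFun_map_eq (Lp.aestronglyMeasurable x).aemeasurable]
    refine forall_congr' fun t => ?_
    have h1 : ∫ ω, inner ℝ t (x ω) ∂P = t * ∫ ω, x ω ∂P := by
      rw [← integral_const_mul]; simp [mul_comm]
    have h2 : Var[fun ω => inner ℝ t (x ω); P] = t ^ 2 * Var[x; P] := by
      rw [← variance_const_mul]; simp [mul_comm]
    rw [h1, h2]
  rw [this]
  refine isClosed_iInter fun t => isClosed_eq (continuous_charFun_two t) ?_
  have h1 := continuous_integral_two (P := P)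
  have h2 := continuous_variance_two (P := P)
  fun_prop

end MeasureTheory.Lp

namespace ProbabilityTheory

variable {Ω T : Type*} [MeasurableSpace Ω] {P : Measure Ω} [IsProbabilityMeasure P]

/-- A process is Gaussian if each of its values is the `L²` limit of the corresponding values of
a sequence of Gaussian processes. -/
lemma IsGaussianProcess.of_tendsto_eLpNorm {X : ℕ → T → Ω → ℝ} {Y : T → Ω → ℝ}
    (hX : ∀ n, IsGaussianProcess (X n) P) (hY : ∀ t, MemLp (Y t) 2 P)
    (h : ∀ t, Tendsto (fun n => eLpNorm (X n t - Y t) 2 P) atTop (𝓝 0)) :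
    IsGaussianProcess Y P where
  hasGaussianLaw I := by
    classical
    have hXm : ∀ n t, MemLp (X n t) 2 P := fun n t => ((hX n).hasGaussianLaw_eval t).memLp_two
    have hmeas : AEMeasurable (fun ω => I.restrict (Y · ω)) P :=
      aemeasurable_pi_lambda _ fun t => (hY t).aestronglyMeasurable.aemeasurable
    have hlim : ∀ t, Tendsto (fun n => (hXm n t).toLp (X n t)) atTop (𝓝 ((hY t).toLp (Y t))) :=
      fun t => (Lp.tendsto_Lp_iff_tendsto_eLpNorm'' _ _ _ _).2 (h t)
    rw [hasGaussianLaw_iff_charFunDual_map_eq hmeas]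
    intro L
    have hL : ∀ x : I → ℝ, L x = ∑ t, L (Pi.single t 1) * x t := fun x => by
      have hx : x = ∑ t, x t • (Pi.single t (1 : ℝ) : I → ℝ) := by
        ext s
        simp [Finset.sum_apply, Pi.single_apply]
      conv_lhs => rw [hx]
      simp [mul_comm]
    set y : Lp ℝ 2 P := ∑ t : I, L (Pi.single t 1) • (hY t).toLp (Y t) with hy
    have hsum : ∀ (Z : T → Ω → ℝ) (hZ : ∀ t, MemLp (Z t) 2 P),
        ((∑ t : I, L (Pi.single t 1) • (hZ t).toLp (Z t) : Lp ℝ 2 P) : Ω → ℝ)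
          =ᵐ[P] L ∘ fun ω => I.restrict (Z · ω) := fun Z hZ => by
      have h1 := Lp.coeFn_finsetSum (μ := P) (p := 2) (Finset.univ : Finset I)
        (fun t : I => L (Pi.single t 1) • (hZ t).toLp (Z t))
      have h2 : ∀ᵐ ω ∂P, ∀ t : I, (L (Pi.single t 1) • (hZ t).toLp (Z t) : Lp ℝ 2 P) ω =
          L (Pi.single t 1) * Z t ω := by
        refine ae_all_iff.2 fun t => ?_
        filter_upwards [Lp.coeFn_smul (L (Pi.single t 1)) ((hZ t).toLp (Z t)),
          (hZ t).coeFn_toLp] with ω h3 h4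
        rw [h3, Pi.smul_apply, h4, smul_eq_mul]
      filter_upwards [h1, h2] with ω h3 h4
      rw [h3, Function.comp_apply, hL, Finset.sum_apply]
      exact Finset.sum_congr rfl fun t _ => h4 t
    have hyG : HasGaussianLaw y P := by
      have hmem : y ∈ {x : Lp ℝ 2 P | HasGaussianLaw x P} :=
        Lp.isClosed_hasGaussianLaw.mem_of_tendsto
        (f := fun n => ∑ t : I, L (Pi.single t 1) • (hXm n t).toLp (X n t)) (b := atTop)
        (tendsto_finsetSum _ fun t _ => (hlim t).const_smul _)
        (Eventually.of_forall fun n =>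
          (((hX n).hasGaussianLaw I).map L).congr (hsum _ (hXm n)).symm)
      exact hmem
    have := (hyG.congr (hsum Y hY)).charFun_map_eq 1
    rw [charFunDual_eq_charFun_map_one]
    rw [AEMeasurable.map_map_of_aemeasurable (by fun_prop) hmeas, this]
    simp [Function.comp_def]

end ProbabilityTheory

/-! ### The Itô isometry -/

lemma MeasureTheory.Lp.inner_toLp {α : Type*} [MeasurableSpace α] {μ : Measure α} {x y : α → ℝ}
    (hx : MemLp x 2 μ) (hy : MemLp y 2 μ) :
    inner ℝ (hx.toLp x) (hy.toLp y) = ∫ a, x a * y a ∂μ := by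
  rw [← Lp.integral_mul_eq_inner]
  refine integral_congr_ae ?_
  filter_upwards [hx.coeFn_toLp, hy.coeFn_toLp] with a h1 h2
  rw [h1, h2]

namespace FSV

lemma StepFunction.eval_eq_sum_indicator (f : StepFunction) :
    f.eval = fun u => ∑ j ∈ Finset.range f.n,
      f.c j * (Ioc (f.s j : ℝ) (f.s (j + 1))).indicator 1 u := by
  funext u
  refine Finset.sum_congr rfl fun j _ => ?_
  by_cases h : (f.s j : ℝ) < u ∧ u ≤ (f.s (j + 1) : ℝ)
  · rw [if_pos h, indicator_of_mem (by exact h)]; simp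
  · rw [if_neg h, indicator_of_notMem (by exact h)]; simp

lemma StepFunction.memLp_eval (f : StepFunction) : MemLp f.eval 2 volume := by
  rw [f.eval_eq_sum_indicator]
  refine memLp_finsetSum _ fun j _ => MemLp.const_mul ?_ _
  exact memLp_indicator_const 2 measurableSet_Ioc 1 (Or.inr (by simp))

lemma StepFunction.eval_eq_zero {f : StepFunction} {t : ℝ≥0} (hf : ∀ j, f.s j ≤ t) {u : ℝ}
    (hu : u ∉ Icc (0 : ℝ) t) : f.eval u = 0 := by
  refine Finset.sum_eq_zero fun j _ => if_neg fun h => hu ⟨?_, ?_⟩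
  · exact (NNReal.coe_nonneg _).trans h.1.le
  · exact h.2.trans (by exact_mod_cast hf (j + 1))

lemma integral_indicator_Ioc_mul (a b c d : ℝ) :
    ∫ u, (Ioc a b).indicator (1 : ℝ → ℝ) u * (Ioc c d).indicator 1 u
      = max (min b d - max a c) 0 := by
  have : (fun u => (Ioc a b).indicator (1 : ℝ → ℝ) u * (Ioc c d).indicator 1 u)
      = (Ioc (max a c) (min b d)).indicator 1 := by
    funext u
    rw [← inter_indicator_mul, Ioc_inter_Ioc]
    simp [indicator]
  rw [this, integral_indicator_one measurableSet_Ioc]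
  simp [Measure.real, Real.volume_Ioc, ENNReal.toReal_ofReal']

variable {Ω : Type*} [MeasurableSpace Ω] {P : Measure Ω} {B : ℝ≥0 → Ω → ℝ}

lemma memLp_two_of_isPreBrownianReal (hB : IsPreBrownianReal B P) (t : ℝ≥0) : MemLp (B t) 2 P :=
  (hB.isGaussianProcess.hasGaussianLaw_eval t).memLp_two

lemma StepFunction.memLp_stochInt (f : StepFunction) (hB : IsPreBrownianReal B P) :
    MemLp (f.stochInt B) 2 P :=
  memLp_finsetSum _ fun _ _ => MemLp.const_mul
    ((memLp_two_of_isPreBrownianReal hB _).sub (memLp_two_of_isPreBrownianReal hB _)) _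

lemma isGaussianProcess_stochInt {T : Type*} (F : T → StepFunction) (hB : IsPreBrownianReal B P) :
    IsGaussianProcess (fun t => (F t).stochInt B) P := by
  classical
  refine hB.isGaussianProcess.of_isGaussianProcess fun t => ?_
  set J : Finset ℝ≥0 :=
    (Finset.univ : Finset (Fin ((F t).n + 1))).image fun j : Fin ((F t).n + 1) => (F t).s j
  have hmem : ∀ j : Fin ((F t).n + 1), (F t).s (j : ℕ) ∈ J :=
    fun j => Finset.mem_image.2 ⟨j, Finset.mem_univ j, rfl⟩
  refine ⟨J,
    ∑ j : Fin (F t).n, (F t).c j • (ContinuousLinearMap.proj (R := ℝ) ⟨_, hmem j.succ⟩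
      - ContinuousLinearMap.proj (R := ℝ) ⟨_, hmem j.castSucc⟩), fun ω => ?_⟩
  simp only [StepFunction.stochInt]
  rw [Finset.sum_range]
  simp

lemma StepFunction.integral_stochInt (f : StepFunction) (hB : IsPreBrownianReal B P) :
    ∫ ω, f.stochInt B ω ∂P = 0 := by
  simp only [StepFunction.stochInt]
  have h1 : ∀ i, Integrable (fun ω => f.c i * (B (f.s (i + 1)) ω - B (f.s i) ω)) P := fun i =>
    ((hB.integrable_eval _).sub (hB.integrable_eval _)).const_mul _
  rw [integral_finsetSum _ fun i _ => h1 i]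
  refine Finset.sum_eq_zero fun i _ => ?_
  rw [integral_const_mul, integral_sub (hB.integrable_eval _) (hB.integrable_eval _),
    hB.integral_eval, hB.integral_eval, sub_self, mul_zero]

variable [IsProbabilityMeasure P]

lemma integral_mul_of_isPreBrownianReal (hB : IsPreBrownianReal B P) (s t : ℝ≥0) :
    ∫ ω, B s ω * B t ω ∂P = min (s : ℝ) t := by
  have h := covariance_eq_sub (memLp_two_of_isPreBrownianReal hB s)
    (memLp_two_of_isPreBrownianReal hB t)
  rw [hB.covariance_eval, hB.integral_eval, hB.integral_eval] at h
  simp only [Pi.mul_apply, mul_zero, sub_zero] at h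
  rw [← h]; simp

/-- The covariance of two Brownian increments is the length of the overlap of their intervals. -/
lemma integral_increment_mul_increment (hB : IsPreBrownianReal B P) {a b c d : ℝ≥0} (hab : a ≤ b)
    (hcd : c ≤ d) :
    ∫ ω, (B b ω - B a ω) * (B d ω - B c ω) ∂P = max (min (b : ℝ) d - max (a : ℝ) c) 0 := by
  have hi : ∀ s t : ℝ≥0, Integrable (fun ω => B s ω * B t ω) P := fun s t =>
    (memLp_two_of_isPreBrownianReal hB s).integrable_mul (memLp_two_of_isPreBrownianReal hB t)
  have : ∀ ω, (B b ω - B a ω) * (B d ω - B c ω)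
      = (B b ω * B d ω - B b ω * B c ω) - (B a ω * B d ω - B a ω * B c ω) := fun ω => by ring
  simp_rw [this]
  have h12 := integral_sub ((hi b d).sub (hi b c)) ((hi a d).sub (hi a c))
  simp only [Pi.sub_apply] at h12
  rw [h12, integral_sub (hi _ _) (hi _ _), integral_sub (hi _ _) (hi _ _)]
  simp only [integral_mul_of_isPreBrownianReal hB]
  have h1 : (a : ℝ) ≤ b := hab
  have h2 : (c : ℝ) ≤ d := hcd
  grind

/-- The Itô isometry for elementary integrals, in polarized form. -/
lemma StepFunction.integral_stochInt_mul (f f' : StepFunction) (hB : IsPreBrownianReal B P) :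
    ∫ ω, f.stochInt B ω * f'.stochInt B ω ∂P = ∫ u, f.eval u * f'.eval u := by
  have hd : ∀ s t : ℝ≥0, MemLp (fun ω => B s ω - B t ω) 2 P := fun s t =>
    (memLp_two_of_isPreBrownianReal hB s).sub (memLp_two_of_isPreBrownianReal hB t)
  have hI : ∀ a b : ℝ, MemLp ((Ioc a b).indicator (1 : ℝ → ℝ)) 2 volume := fun a b =>
    memLp_indicator_const 2 measurableSet_Ioc 1 (Or.inr (by simp))
  rw [f.eval_eq_sum_indicator, f'.eval_eq_sum_indicator]
  simp only [StepFunction.stochInt, Finset.sum_mul_sum]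
  have h1 : ∀ i j, Integrable (fun ω => f.c i * (B (f.s (i + 1)) ω - B (f.s i) ω) *
      (f'.c j * (B (f'.s (j + 1)) ω - B (f'.s j) ω))) P := fun i j =>
    ((hd _ _).const_mul _).integrable_mul ((hd _ _).const_mul _)
  have h2 : ∀ i j, Integrable (fun u => f.c i * (Ioc (f.s i : ℝ) (f.s (i + 1))).indicator 1 u *
      (f'.c j * (Ioc (f'.s j : ℝ) (f'.s (j + 1))).indicator 1 u)) volume := fun i j =>
    ((hI _ _).const_mul _).integrable_mul ((hI _ _).const_mul _)
  rw [integral_finsetSum _ fun i _ => integrable_finsetSum _ fun j _ => h1 i j,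
    integral_finsetSum _ fun i _ => integrable_finsetSum _ fun j _ => h2 i j]
  refine Finset.sum_congr rfl fun i _ => ?_
  rw [integral_finsetSum _ fun j _ => h1 i j, integral_finsetSum _ fun j _ => h2 i j]
  refine Finset.sum_congr rfl fun j _ => ?_
  simp only [mul_mul_mul_comm (f.c i) _ (f'.c j)]
  rw [integral_const_mul, integral_const_mul, integral_indicator_Ioc_mul,
    integral_increment_mul_increment hB (f.mono (Nat.le_succ _)) (f'.mono (Nat.le_succ _))]

/-- The Itô integrals of a deterministic function over the intervals `[0, τ t]` form a centered
Gaussian process, with the covariance given by the Itô isometry. -/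
theorem IsItoIntegral.isGaussianProcess {T : Type*} {τ : T → ℝ≥0} {I : T → Ω → ℝ} {h : ℝ → ℝ}
    (hB : IsPreBrownianReal B P) (hI : ∀ t, IsItoIntegral P B h (τ t) (I t))
    (hh : ∀ t, MemLp ((Icc (0 : ℝ) (τ t)).indicator h) 2 volume) :
    IsGaussianProcess I P ∧ (∀ t, ∫ ω, I t ω ∂P = 0) ∧
      ∀ s t, ∫ ω, I s ω * I t ω ∂P = ∫ u in Icc (0 : ℝ) (min (τ s) (τ t)), h u ^ 2 := by
  choose hI2 F hFt hFh hFI using hI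
  have hJ : ∀ n t, MemLp ((F t n).stochInt B) 2 P := fun n t => (F t n).memLp_stochInt hB
  have hFI' : ∀ t, Tendsto (fun n => eLpNorm ((F t n).stochInt B - I t) 2 P) atTop (𝓝 0) :=
    fun t => by
      refine (hFI t).congr fun n => ?_
      exact eLpNorm_sub_comm _ _ _ _
  have hlimI : ∀ t, Tendsto (fun n => (hJ n t).toLp _) atTop (𝓝 ((hI2 t).toLp (I t))) :=
    fun t => (Lp.tendsto_Lp_iff_tendsto_eLpNorm'' _ _ _ _).2 (hFI' t)
  have hFh' : ∀ t, Tendsto (fun n => eLpNorm ((F t n).eval - (Icc (0 : ℝ) (τ t)).indicator h) 2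
      volume) atTop (𝓝 0) := fun t => by
    have h0 := (ENNReal.continuous_rpow_const (y := (1 / 2 : ℝ))).continuousAt.tendsto.comp (hFh t)
    rw [ENNReal.zero_rpow_of_pos (by norm_num)] at h0
    refine h0.congr fun n => ?_
    rw [eLpNorm_eq_lintegral_rpow_enorm_toReal (by norm_num) (by norm_num)]
    simp only [Function.comp_apply, ENNReal.toReal_ofNat]
    congr 1
    rw [← lintegral_indicator measurableSet_Icc]
    refine lintegral_congr fun u => ?_
    by_cases hu : u ∈ Icc (0 : ℝ) (τ t)
    · rw [indicator_of_mem hu, Pi.sub_apply, indicator_of_mem hu, ← enorm_neg, neg_sub,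
        ← ofReal_norm, ENNReal.ofReal_rpow_of_nonneg (norm_nonneg _) (by norm_num)]
      simp
    · rw [indicator_of_notMem hu, Pi.sub_apply, indicator_of_notMem hu,
        StepFunction.eval_eq_zero (hFt t n) hu]
      simp
  have hE : ∀ n t, MemLp (F t n).eval 2 volume := fun n t => (F t n).memLp_eval
  have hlimh : ∀ t, Tendsto (fun n => (hE n t).toLp _) atTop (𝓝 ((hh t).toLp _)) :=
    fun t => (Lp.tendsto_Lp_iff_tendsto_eLpNorm'' _ _ _ _).2 (hFh' t)
  refine ⟨IsGaussianProcess.of_tendsto_eLpNorm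
    (X := fun n t => (F t n).stochInt B) (fun n => isGaussianProcess_stochInt _ hB) hI2 hFI',
    fun t => ?_, fun s t => ?_⟩
  · have h1 := (Lp.continuous_integral_two (P := P)).continuousAt.tendsto.comp (hlimI t)
    have h2 : ∀ n, ∫ ω, (hJ n t).toLp _ ω ∂P = 0 := fun n => by
      rw [integral_congr_ae (hJ n t).coeFn_toLp, StepFunction.integral_stochInt _ hB]
    rw [← integral_congr_ae (hI2 t).coeFn_toLp]
    exact tendsto_nhds_unique h1 (tendsto_const_nhds.congr fun n => (h2 n).symm)
  · have h1 := (hlimI s).inner (𝕜 := ℝ) (hlimI t)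
    have h2 := (hlimh s).inner (𝕜 := ℝ) (hlimh t)
    simp only [Lp.inner_toLp] at h1 h2
    simp only [StepFunction.integral_stochInt_mul _ _ hB] at h1
    rw [tendsto_nhds_unique h1 h2, ← integral_indicator measurableSet_Icc]
    congr 1
    funext u
    rw [← inter_indicator_mul, Icc_inter_Icc]
    simp [pow_two]

end FSV

/-! ### Increments of a Gaussian martingale -/

namespace ProbabilityTheory

variable {Ω : Type*} [MeasurableSpace Ω] {P : Measure Ω} [IsProbabilityMeasure P]

/-- A centered Gaussian sequence with covariance `V (min j k)` has independent increments. -/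
lemma IsGaussianProcess.iIndepFun_increments {X : ℕ → Ω → ℝ} {V : ℕ → ℝ}
    (hX : IsGaussianProcess X P) (h0 : ∀ k, ∫ ω, X k ω ∂P = 0)
    (hV : ∀ j k, ∫ ω, X j ω * X k ω ∂P = V (min j k)) :
    iIndepFun (fun k ω => X (k + 1) ω - X k ω) P ∧
      ∀ k, HasLaw (fun ω => X (k + 1) ω - X k ω)
        (gaussianReal 0 (V (k + 1) - V k).toNNReal) P := by
  have hL : ∀ k, MemLp (X k) 2 P := fun k => (hX.hasGaussianLaw_eval k).memLp_two
  have hi : ∀ k, Integrable (X k) P := fun k => (hX.hasGaussianLaw_eval k).integrable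
  have hcov : ∀ j k, cov[X j, X k; P] = V (min j k) := fun j k => by
    rw [covariance_eq_sub (hL j) (hL k), h0, h0, ← hV]; simp
  have hDcov : ∀ j k, cov[fun ω => X (j + 1) ω - X j ω, fun ω => X (k + 1) ω - X k ω; P]
      = V (min (j + 1) (k + 1)) - V (min (j + 1) k) - (V (min j (k + 1)) - V (min j k)) :=
    fun j k => by
      have := covariance_sub_left (hL (j + 1)) (hL j) ((hL (k + 1)).sub (hL k))
      rw [covariance_sub_right (hL _) (hL _) (hL _), covariance_sub_right (hL _) (hL _) (hL _),
        hcov, hcov, hcov, hcov] at this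
      exact this
  have hD : IsGaussianProcess (fun k ω => X (k + 1) ω - X k ω) P := by
    refine hX.of_isGaussianProcess fun k => ⟨{k, k + 1},
      ContinuousLinearMap.proj (R := ℝ) ⟨k + 1, by simp⟩
        - ContinuousLinearMap.proj (R := ℝ) ⟨k, by simp⟩, fun ω => by simp⟩
  constructor
  · rw [iIndepFun_iff_finset]
    intro s
    refine HasGaussianLaw.iIndepFun_of_covariance_eq_zero (hD.hasGaussianLaw s) fun i j hij => ?_
    have hne : (i : ℕ) ≠ j := fun h => hij (Subtype.ext h)
    simp only [Finset.restrict]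
    rw [hDcov]
    rcases lt_or_gt_of_ne hne with h | h
    · rw [min_eq_left (by omega), min_eq_left (by omega), min_eq_left (by omega),
        min_eq_left (by omega)]
      ring
    · rw [min_eq_right (by omega), min_eq_right (by omega), min_eq_right (by omega),
        min_eq_right (by omega)]
      ring
  · intro k
    refine ⟨hD.aemeasurable k, ?_⟩
    rw [(hD.hasGaussianLaw_eval k).map_eq_gaussianReal]
    have hvar : Var[fun ω => X (k + 1) ω - X k ω; P] = V (k + 1) - V k := by
      rw [← covariance_self (hD.aemeasurable k), hDcov]
      rw [min_self, min_self, min_eq_right (by omega), min_eq_left (by omega)]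
      ring
    rw [hvar, integral_sub (hi _) (hi _), h0, h0, sub_zero]

end ProbabilityTheory

/-! ### A maximal inequality for sums of independent random variables -/

/-- The pathwise form of Doob's `L²` maximal inequality. -/
lemma sq_partialSups_le {x : ℕ → ℝ} (h0 : x 0 = 0) (n : ℕ) :
    partialSups x n ^ 2 ≤
      4 * x n ^ 2 - 4 * ∑ k ∈ Finset.range n, partialSups x k * (x (k + 1) - x k) := by
  have key : ∑ k ∈ Finset.range n, partialSups x k * (x (k + 1) - x k)
      ≤ partialSups x n * x n - partialSups x n ^ 2 / 2 := by
    induction n with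
    | zero => simp [h0]
    | succ n ih =>
      rw [Finset.sum_range_succ, partialSups_add_one]
      rcases le_total (x (n + 1)) (partialSups x n) with h | h
      · rw [sup_eq_left.2 h]; linarith
      · rw [sup_eq_right.2 h]; nlinarith [sq_nonneg (x (n + 1) - partialSups x n)]
  nlinarith [sq_nonneg (partialSups x n - 2 * x n)]

namespace ProbabilityTheory

variable {Ω : Type*} [MeasurableSpace Ω] {P : Measure Ω}

lemma measurable_partialSups_abs_sum (n : ℕ) : Measurable fun z : ℕ → ℝ =>
    partialSups (fun j => |∑ i ∈ Finset.range j, z i|) n := by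
  induction n with
  | zero => simp
  | succ n ih =>
    simp_rw [partialSups_add_one]
    exact ih.sup (by fun_prop)

lemma memLp_partialSups_abs_sum {ξ : ℕ → Ω → ℝ} (hL : ∀ k, MemLp (ξ k) 2 P) (n : ℕ) :
    MemLp (fun ω => partialSups (fun j => |∑ i ∈ Finset.range j, ξ i ω|) n) 2 P := by
  induction n with
  | zero => simp
  | succ n ih =>
    simp_rw [partialSups_add_one]
    exact ih.sup (memLp_finsetSum _ fun i _ => hL i).abs

/-- The running maximum of the partial sums is a predictable integrand: its integral against the
submartingale of their absolute values has nonnegative mean. -/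
lemma iIndepFun.integral_partialSups_mul_nonneg {ξ : ℕ → Ω → ℝ} (hind : iIndepFun ξ P)
    (hL : ∀ k, MemLp (ξ k) 2 P) (h0 : ∀ k, ∫ ω, ξ k ω ∂P = 0) (n : ℕ) :
    0 ≤ ∫ ω, partialSups (fun j => |∑ i ∈ Finset.range j, ξ i ω|) n *
      (|∑ i ∈ Finset.range (n + 1), ξ i ω| - |∑ i ∈ Finset.range n, ξ i ω|) ∂P := by
  classical
  have hM : ∀ n, MemLp (fun ω => ∑ i ∈ Finset.range n, ξ i ω) 2 P := fun n =>
    memLp_finsetSum _ fun i _ => hL i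
  have hY := memLp_partialSups_abs_sum hL n
  -- `|M + x| - |M| ≥ sign M * x`, and the coefficient of `x = ξ n` obtained in this way is a
  -- function `Ψ` of `ξ 0, …, ξ (n - 1)` only, hence independent of `ξ n`.
  set Ψ : (ℕ → ℝ) → ℝ := fun z => partialSups (fun j => |∑ i ∈ Finset.range j, z i|) n *
    SignType.sign (∑ i ∈ Finset.range n, z i) with hΨ
  have hΨm : Measurable Ψ := by
    refine (measurable_partialSups_abs_sum n).mul ?_
    have h1 : Measurable fun z : ℕ → ℝ => ∑ i ∈ Finset.range n, z i := by fun_prop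
    have h2 : Measurable fun a : ℝ => ((SignType.sign a : SignType) : ℝ) := by
      have : (fun a : ℝ => ((SignType.sign a : SignType) : ℝ)) =
          fun a => if 0 < a then 1 else if a < 0 then -1 else 0 := by
        funext a
        rw [sign_apply]
        split_ifs <;> simp
      rw [this]
      exact Measurable.ite measurableSet_Ioi measurable_const
        (Measurable.ite measurableSet_Iio measurable_const measurable_const)
    exact h2.comp h1
  set ext : (Finset.range n → ℝ) → ℕ → ℝ := fun z i =>
    if h : i ∈ Finset.range n then z ⟨i, h⟩ else 0 with hext
  have hextm : Measurable ext := by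
    refine measurable_pi_lambda _ fun i => ?_
    by_cases h : i ∈ Finset.range n
    · simp only [hext, h, dite_true]; fun_prop
    · simp only [hext, h, dite_false]; fun_prop
  have hΨext : ∀ z : ℕ → ℝ, Ψ (ext fun i => z i) = Ψ z := fun z => by
    have hs : ∀ j ≤ n, ∑ i ∈ Finset.range j, ext (fun i => z i) i = ∑ i ∈ Finset.range j, z i :=
      fun j hj => Finset.sum_congr rfl fun i hi => by
        have : i ∈ Finset.range n := by simp at hi ⊢; omega
        simp only [hext, this, dite_true]
    simp only [hΨ]
    rw [hs n le_rfl, partialSups_eq_sup'_range, partialSups_eq_sup'_range]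
    congr 1
    refine Finset.sup'_congr _ rfl fun j hj => ?_
    rw [hs j (by simp at hj; omega)]
  have hindep : IndepFun (fun ω => Ψ fun i => ξ i ω) (ξ n) P := by
    have h := hind.indepFun_finset₀ (Finset.range n) {n} (by simp)
      fun i => (hL i).aestronglyMeasurable.aemeasurable
    have h2 := h.comp (hΨm.comp hextm)
      (measurable_pi_apply (⟨n, by simp⟩ : ({n} : Finset ℕ)))
    refine h2.congr (Eventually.of_forall fun ω => ?_) (Eventually.of_forall fun ω => rfl)
    exact hΨext fun i => ξ i ω
  have hnn : ∀ ω, 0 ≤ partialSups (fun j => |∑ i ∈ Finset.range j, ξ i ω|) n := fun ω =>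
    (abs_nonneg _).trans (le_partialSups_of_le (fun j => |∑ i ∈ Finset.range j, ξ i ω|) le_rfl)
  have hsign : ∀ a : ℝ, |((SignType.sign a : SignType) : ℝ)| ≤ 1 := fun a => by
    rcases lt_trichotomy a 0 with h | h | h <;> simp [h, sign_neg, sign_pos]
  have hΨL : MemLp (fun ω => Ψ fun i => ξ i ω) 2 P := by
    refine hY.mono ?_ (Eventually.of_forall fun ω => ?_)
    · exact (hΨm.comp_aemeasurable (aemeasurable_pi_lambda _ fun i =>
        (hL i).aestronglyMeasurable.aemeasurable)).aestronglyMeasurable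
    · simp only [hΨ, norm_mul, Real.norm_eq_abs]
      exact mul_le_of_le_one_right (abs_nonneg _) (hsign _)
  have hzero : ∫ ω, Ψ (fun i => ξ i ω) * ξ n ω ∂P = 0 := by
    rw [hindep.integral_fun_mul_eq_mul_integral hΨL.aestronglyMeasurable
      (hL n).aestronglyMeasurable, h0, mul_zero]
  rw [← hzero]
  refine integral_mono (hΨL.integrable_mul (hL n))
    (hY.integrable_mul ((hM (n + 1)).abs.sub (hM n).abs)) fun ω => ?_
  simp only [hΨ]
  rw [mul_assoc, Finset.sum_range_succ]
  refine mul_le_mul_of_nonneg_left ?_ (hnn ω)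
  have : ∀ a b : ℝ, ((SignType.sign a : SignType) : ℝ) * b ≤ |a + b| - |a| := fun a b => by
    rcases lt_trichotomy a 0 with h | h | h
    · rw [sign_neg h, abs_of_neg h]; simp; linarith [neg_abs_le (a + b)]
    · simp [h]
    · rw [sign_pos h, abs_of_pos h]; simp; linarith [le_abs_self (a + b)]
  exact this _ _

variable [IsProbabilityMeasure P]

/-- Independent centered random variables are orthogonal in `L²`. -/
lemma iIndepFun.integral_sq_sum {ι : Type*} {ξ : ι → Ω → ℝ} (hind : iIndepFun ξ P)
    (hL : ∀ k, MemLp (ξ k) 2 P) (h0 : ∀ k, ∫ ω, ξ k ω ∂P = 0) (s : Finset ι) :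
    ∫ ω, (∑ i ∈ s, ξ i ω) ^ 2 ∂P = ∑ k ∈ s, ∫ ω, ξ k ω ^ 2 ∂P := by
  have h1 := IndepFun.variance_sum (s := s) (X := ξ) (μ := P)
    (fun i _ => hL i) (fun i _ j _ hij => hind.indepFun hij)
  have hsum : ∑ i ∈ s, ξ i = fun ω => ∑ i ∈ s, ξ i ω := by ext; simp
  rw [hsum, variance_of_integral_eq_zero
    (memLp_finsetSum _ fun i _ => hL i).aestronglyMeasurable.aemeasurable] at h1
  · rw [h1]
    exact Finset.sum_congr rfl fun k _ => variance_of_integral_eq_zero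
      (hL k).aestronglyMeasurable.aemeasurable (h0 k)
  · rw [integral_finsetSum _ fun i _ => (hL i).integrable (by norm_num)]
    exact Finset.sum_eq_zero fun i _ => h0 i

/-- Doob's `L²` maximal inequality for the partial sums of independent centered random
variables. -/
theorem iIndepFun.integral_sq_partialSups_le {ξ : ℕ → Ω → ℝ} (hind : iIndepFun ξ P)
    (hL : ∀ k, MemLp (ξ k) 2 P) (h0 : ∀ k, ∫ ω, ξ k ω ∂P = 0) (n : ℕ) :
    ∫ ω, partialSups (fun j => |∑ i ∈ Finset.range j, ξ i ω|) n ^ 2 ∂P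
      ≤ 4 * ∑ k ∈ Finset.range n, ∫ ω, ξ k ω ^ 2 ∂P := by
  have hM : ∀ n, MemLp (fun ω => ∑ i ∈ Finset.range n, ξ i ω) 2 P := fun n =>
    memLp_finsetSum _ fun i _ => hL i
  have hvar : ∫ ω, (∑ i ∈ Finset.range n, ξ i ω) ^ 2 ∂P
      = ∑ k ∈ Finset.range n, ∫ ω, ξ k ω ^ 2 ∂P :=
    hind.integral_sq_sum hL h0 _
  have hY := fun k => memLp_partialSups_abs_sum hL k
  have hterm : ∀ k, Integrable (fun ω => partialSups (fun j => |∑ i ∈ Finset.range j, ξ i ω|) k *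
      (|∑ i ∈ Finset.range (k + 1), ξ i ω| - |∑ i ∈ Finset.range k, ξ i ω|)) P := fun k =>
    (hY k).integrable_mul ((hM (k + 1)).abs.sub (hM k).abs)
  calc _ ≤ ∫ ω, (4 * (∑ i ∈ Finset.range n, ξ i ω) ^ 2 - 4 * ∑ k ∈ Finset.range n,
          partialSups (fun j => |∑ i ∈ Finset.range j, ξ i ω|) k *
          (|∑ i ∈ Finset.range (k + 1), ξ i ω| - |∑ i ∈ Finset.range k, ξ i ω|)) ∂P := by
        refine integral_mono (hY n).integrable_sq (((hM n).integrable_sq.const_mul 4).sub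
          ((integrable_finsetSum _ fun k _ => hterm k).const_mul 4)) fun ω => ?_
        have := sq_partialSups_le (x := fun j => |∑ i ∈ Finset.range j, ξ i ω|) (by simp) n
        simpa only [sq_abs] using this
    _ ≤ _ := by
        rw [integral_sub ((hM n).integrable_sq.const_mul 4)
          ((integrable_finsetSum _ fun k _ => hterm k).const_mul 4), integral_const_mul,
          integral_const_mul, hvar, integral_finsetSum _ fun k _ => hterm k]
        have := Finset.sum_nonneg fun k (_ : k ∈ Finset.range n) =>
          hind.integral_partialSups_mul_nonneg hL h0 k
        linarith

end ProbabilityTheory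

/-! ### The logarithm of a weighted sum of squares of Gaussian variables -/

namespace ProbabilityTheory

lemma integrable_abs_rpow_neg_half_gaussianReal :
    Integrable (fun x : ℝ => |x| ^ (-(1 / 2) : ℝ)) (gaussianReal 0 1) := by
  rw [gaussianReal_of_var_ne_zero _ one_ne_zero,
    integrable_withDensity_iff_integrable_smul' (measurable_gaussianPDF 0 1)
      (Eventually.of_forall fun x => gaussianPDF_lt_top)]
  have h1 : Integrable fun x : ℝ => x ^ (-(1 / 2) : ℝ) * Real.exp (-(1 / 2) * x ^ 2) :=
    integrable_rpow_mul_exp_neg_mul_sq (by norm_num) (by norm_num)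
  have h2 := h1.comp_neg
  have hm : Measurable fun x : ℝ => |x| ^ (-(1 / 2) : ℝ) := by fun_prop
  refine ((h1.norm.add h2.norm).const_mul (√(2 * Real.pi))⁻¹).mono'
    (((measurable_gaussianPDF 0 1).ennreal_toReal.smul hm).aestronglyMeasurable)
    (Eventually.of_forall fun x => ?_)
  rw [toReal_gaussianPDF, gaussianPDFReal]
  have hexp : (0 : ℝ) < Real.exp (-(1 / 2) * x ^ 2) := Real.exp_pos _
  have he : Real.exp (-(x - 0) ^ 2 / (2 * ((1 : ℝ≥0) : ℝ))) = Real.exp (-(1 / 2) * x ^ 2) := by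
    congr 1; push_cast; ring
  rw [he]
  simp only [NNReal.coe_one, mul_one, Pi.add_apply, norm_mul, neg_sq, smul_eq_mul,
    Real.norm_eq_abs, abs_of_pos hexp]
  rw [abs_of_nonneg (by positivity : 0 ≤ (√(2 * Real.pi))⁻¹),
    abs_of_nonneg (by positivity : (0 : ℝ) ≤ |x| ^ (-(1 / 2) : ℝ)), mul_assoc, ← add_mul,
    mul_comm (Real.exp _)]
  refine mul_le_mul_of_nonneg_left (mul_le_mul_of_nonneg_right ?_ hexp.le) (by positivity)
  rcases le_total 0 x with h | h
  · rw [abs_of_nonneg h]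
    exact (le_abs_self _).trans (le_add_of_nonneg_right (abs_nonneg _))
  · rw [abs_of_nonpos h]
    exact (le_abs_self _).trans (le_add_of_nonneg_left (abs_nonneg _))

lemma sq_log_le (x : ℝ) : Real.log x ^ 2 ≤ 16 * |x| ^ (-(1 / 2) : ℝ) + x ^ 2 := by
  rw [← Real.log_abs, ← sq_abs x]
  rcases (abs_nonneg x).eq_or_lt with h | h
  · rw [← h]; simp
  generalize |x| = y at h
  have hy : 0 < y ^ (-(1 / 2) : ℝ) := Real.rpow_pos_of_pos h _
  rcases le_total y 1 with h1 | h1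
  · have h2 := (Real.abs_log_mul_self_rpow_lt y (1 / 4) h h1 (by norm_num)).le
    have h3 : (Real.log y * y ^ (1 / 4 : ℝ)) ^ 2 ≤ 16 := by
      rw [← sq_abs]; nlinarith [abs_nonneg (Real.log y * y ^ (1 / 4 : ℝ))]
    have h4 : Real.log y ^ 2 = (Real.log y * y ^ (1 / 4 : ℝ)) ^ 2 * y ^ (-(1 / 2) : ℝ) := by
      rw [mul_pow, ← Real.rpow_natCast (y ^ (1 / 4 : ℝ)), ← Real.rpow_mul h.le, mul_assoc,
        ← Real.rpow_add h]
      norm_num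
    rw [h4]
    nlinarith [sq_nonneg y]
  · have h2 := Real.log_nonneg h1
    have h3 := Real.log_le_self h.le
    nlinarith

lemma memLp_log_gaussianReal : MemLp Real.log 2 (gaussianReal 0 1) := by
  refine (memLp_two_iff_integrable_sq Real.measurable_log.aestronglyMeasurable).2 ?_
  have h := (memLp_id_gaussianReal' (μ := 0) (v := 1) 2 (by norm_num)).integrable_sq
  refine ((integrable_abs_rpow_neg_half_gaussianReal.const_mul 16).add h).mono'
    (by fun_prop) (Eventually.of_forall fun x => ?_)
  rw [Real.norm_eq_abs, abs_of_nonneg (sq_nonneg _)]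
  exact sq_log_le x

lemma memLp_sq_gaussianReal : MemLp (fun x : ℝ => x ^ 2) 2 (gaussianReal 0 1) := by
  refine (memLp_two_iff_integrable_sq (by fun_prop)).2 ?_
  have h := (memLp_id_gaussianReal' (μ := 0) (v := 1) 4 (by norm_num)).integrable_norm_pow
    (by norm_num : (4 : ℕ) ≠ 0)
  refine h.congr (Eventually.of_forall fun x => ?_)
  simp only [id, Real.norm_eq_abs]
  rw [← pow_mul, Even.pow_abs (by decide)]

/-- A majorant of `|log (x ^ 2)|` and of `x ^ 2` that is square integrable for the standard
Gaussian law. -/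
noncomputable def logSqMajorant (x : ℝ) : ℝ := 2 * |Real.log x| + x ^ 2

lemma memLp_logSqMajorant : MemLp logSqMajorant 2 (gaussianReal 0 1) :=
  (memLp_log_gaussianReal.abs.const_mul 2).add memLp_sq_gaussianReal

/-- Concavity of the logarithm bounds the logarithm of a weighted sum of squares from below by the
weighted sum of the logarithms, and `log y ≤ y - 1` bounds it from above. -/
lemma abs_log_sum_mul_sq_le {ι : Type*} {s : Finset ι} (hs : s.Nonempty) {a x : ι → ℝ}
    (ha : ∀ i ∈ s, 0 < a i) (hx : ∀ i ∈ s, x i ≠ 0) :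
    |Real.log (∑ i ∈ s, a i * x i ^ 2)| ≤
      |Real.log (∑ i ∈ s, a i)| + ∑ i ∈ s, a i / (∑ j ∈ s, a j) * logSqMajorant (x i) := by
  set A := ∑ j ∈ s, a j with hA
  have hApos : 0 < A := Finset.sum_pos ha hs
  set w : ι → ℝ := fun i => a i / A with hw
  have hwpos : ∀ i ∈ s, 0 < w i := fun i hi => div_pos (ha i hi) hApos
  have hw1 : ∑ i ∈ s, w i = 1 := by
    rw [hw, ← Finset.sum_div, ← hA, div_self hApos.ne']
  have hxpos : ∀ i ∈ s, 0 < x i ^ 2 := fun i hi => by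
    have := hx i hi; positivity
  set T := ∑ i ∈ s, w i * x i ^ 2 with hT
  have hTpos : 0 < T := Finset.sum_pos (fun i hi => mul_pos (hwpos i hi) (hxpos i hi)) hs
  have hsum : ∑ i ∈ s, a i * x i ^ 2 = A * T := by
    rw [hT, Finset.mul_sum]
    refine Finset.sum_congr rfl fun i _ => ?_
    simp only [hw]; field_simp
  rw [hsum, Real.log_mul hApos.ne' hTpos.ne']
  refine (abs_add_le _ _).trans (add_le_add_right ?_ _)
  have hlow : ∑ i ∈ s, w i * Real.log (x i ^ 2) ≤ Real.log T := by
    have := strictConcaveOn_log_Ioi.concaveOn.le_map_sum (t := s) (w := w) (p := fun i => x i ^ 2)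
      (fun i hi => (hwpos i hi).le) hw1 hxpos
    simpa using this
  have hup : Real.log T ≤ T := (Real.log_le_sub_one_of_pos hTpos).trans (by linarith)
  rw [abs_le]
  constructor
  · rw [← Finset.sum_neg_distrib]
    refine le_trans (Finset.sum_le_sum fun i hi => ?_) hlow
    rw [← mul_neg]
    refine mul_le_mul_of_nonneg_left ?_ (hwpos i hi).le
    rw [Real.log_pow, logSqMajorant]
    push_cast
    nlinarith [neg_abs_le (Real.log (x i)), sq_nonneg (x i)]
  · refine hup.trans (Finset.sum_le_sum fun i hi => mul_le_mul_of_nonneg_left ?_ (hwpos i hi).le)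
    rw [logSqMajorant]
    linarith [abs_nonneg (Real.log (x i))]

variable {Ω : Type*} [MeasurableSpace Ω] {P : Measure Ω}

lemma hasLaw_div_sqrt {D : Ω → ℝ} {a : ℝ} (ha : 0 < a)
    (hD : HasLaw D (gaussianReal 0 a.toNNReal) P) :
    HasLaw (fun ω => D ω / √a) (gaussianReal 0 1) P := by
  have h := gaussianReal_div_const hD (√a)
  convert h using 2
  · simp
  · ext
    simp [Real.coe_toNNReal _ ha.le, Real.sq_sqrt ha.le, ha.ne']

lemma ae_ne_zero_of_hasLaw_gaussianReal {D : Ω → ℝ} {a : ℝ} (ha : 0 < a)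
    (hD : HasLaw D (gaussianReal 0 a.toNNReal) P) : ∀ᵐ ω ∂P, D ω ≠ 0 := by
  have hv : a.toNNReal ≠ 0 := by simpa using ha
  have := nullSingletonClass_gaussianReal (μ := 0) hv
  have h : ∀ᵐ x ∂(P.map D), x ≠ 0 := by
    rw [hD.map_eq, ae_iff]
    simp
  exact ae_of_ae_map hD.aemeasurable h

/-- The logarithm of a sum of squares of centered Gaussian variables is bounded in `L²` by a
constant that depends on their variances only through the sum. No independence is needed. -/
lemma eLpNorm_log_sum_sq_le {ι : Type*} {s : Finset ι} (hs : s.Nonempty) {a : ι → ℝ}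
    {D : ι → Ω → ℝ} (ha : ∀ i ∈ s, 0 < a i)
    (hD : ∀ i ∈ s, HasLaw (D i) (gaussianReal 0 (a i).toNNReal) P) [IsProbabilityMeasure P] :
    eLpNorm (fun ω => Real.log (∑ i ∈ s, D i ω ^ 2)) 2 P ≤
      ENNReal.ofReal |Real.log (∑ i ∈ s, a i)| + eLpNorm logSqMajorant 2 (gaussianReal 0 1) := by
  set A := ∑ j ∈ s, a j with hA
  have hApos : 0 < A := Finset.sum_pos ha hs
  have hξ : ∀ i ∈ s, HasLaw (fun ω => D i ω / √(a i)) (gaussianReal 0 1) P := fun i hi =>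
    hasLaw_div_sqrt (ha i hi) (hD i hi)
  have hψm : ∀ i ∈ s, eLpNorm (fun ω => logSqMajorant (D i ω / √(a i))) 2 P
      = eLpNorm logSqMajorant 2 (gaussianReal 0 1) := fun i hi => by
    rw [← (hξ i hi).map_eq, eLpNorm_map_measure _ (hξ i hi).aemeasurable]
    · rfl
    · rw [(hξ i hi).map_eq]; exact memLp_logSqMajorant.aestronglyMeasurable
  have hψa : ∀ i ∈ s, AEStronglyMeasurable (fun ω => logSqMajorant (D i ω / √(a i))) P :=
    fun i hi => by
      have := memLp_logSqMajorant.aestronglyMeasurable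
      rw [← (hξ i hi).map_eq] at this
      exact this.comp_aemeasurable (hξ i hi).aemeasurable
  have hne : ∀ᵐ ω ∂P, ∀ i ∈ s, D i ω ≠ 0 :=
    (Finset.eventually_all s).2 fun i hi => ae_ne_zero_of_hasLaw_gaussianReal (ha i hi) (hD i hi)
  calc eLpNorm (fun ω => Real.log (∑ i ∈ s, D i ω ^ 2)) 2 P
      ≤ eLpNorm ((fun _ => |Real.log A|) +
          fun ω => ∑ i ∈ s, a i / A * logSqMajorant (D i ω / √(a i))) 2 P := by
        refine eLpNorm_mono_ae ?_
        filter_upwards [hne] with ω hω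
        have h := abs_log_sum_mul_sq_le hs ha (x := fun i => D i ω / √(a i)) fun i hi =>
          div_ne_zero (hω i hi) (Real.sqrt_pos.2 (ha i hi)).ne'
        have hsum : ∑ i ∈ s, a i * (D i ω / √(a i)) ^ 2 = ∑ i ∈ s, D i ω ^ 2 :=
          Finset.sum_congr rfl fun i hi => by
            rw [div_pow, Real.sq_sqrt (ha i hi).le, mul_div_cancel₀ _ (ha i hi).ne']
        rw [hsum] at h
        exact h.trans (le_abs_self _)
    _ ≤ eLpNorm (fun _ => |Real.log A|) 2 P +
          eLpNorm (fun ω => ∑ i ∈ s, a i / A * logSqMajorant (D i ω / √(a i))) 2 P :=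
        eLpNorm_add_le (by fun_prop)
          (Finset.aestronglyMeasurable_fun_sum _ fun i hi => (hψa i hi).const_mul _) (by norm_num)
    _ ≤ ENNReal.ofReal |Real.log A| + eLpNorm logSqMajorant 2 (gaussianReal 0 1) := by
        refine add_le_add ?_ ?_
        · rw [eLpNorm_const _ (by norm_num) (NeZero.ne P)]
          simp [← ofReal_norm]
        · have hsum : (fun ω => ∑ i ∈ s, a i / A * logSqMajorant (D i ω / √(a i)))
              = ∑ i ∈ s, (a i / A) • fun ω => logSqMajorant (D i ω / √(a i)) := by
            ext ω; simp
          rw [hsum]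
          refine (eLpNorm_sum_le (fun i hi => (hψa i hi).const_smul _) (by norm_num)).trans ?_
          refine (Finset.sum_le_sum (g := fun i => ENNReal.ofReal (a i / A) *
            eLpNorm logSqMajorant 2 (gaussianReal 0 1)) fun i hi => ?_).trans ?_
          · rw [eLpNorm_const_smul, hψm i hi, ← ofReal_norm, Real.norm_eq_abs,
              abs_of_pos (div_pos (ha i hi) hApos)]
          · rw [← Finset.sum_mul, ← ENNReal.ofReal_sum_of_nonneg fun i hi =>
              (div_pos (ha i hi) hApos).le, ← Finset.sum_div, ← hA, div_self hApos.ne']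
            simp

/-- The variance of the square of a centered Gaussian variable is proportional to the square of
its variance. -/
lemma integral_sq_sub_sq_of_hasLaw_gaussianReal {D : Ω → ℝ} {a : ℝ} (ha : 0 < a)
    (hD : HasLaw D (gaussianReal 0 a.toNNReal) P) :
    ∫ ω, (D ω ^ 2 - a) ^ 2 ∂P = a ^ 2 * ∫ x, (x ^ 2 - 1) ^ 2 ∂(gaussianReal 0 1) := by
  have hξ := hasLaw_div_sqrt ha hD
  rw [← hξ.integral_comp (f := fun x : ℝ => (x ^ 2 - 1) ^ 2) (by fun_prop), ← integral_const_mul]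
  refine integral_congr_ae (Eventually.of_forall fun ω => ?_)
  simp only [Function.comp_apply]
  rw [div_pow, Real.sq_sqrt ha.le]
  field_simp

lemma memLp_sq_sub_of_hasLaw_gaussianReal {D : Ω → ℝ} {a : ℝ} (ha : 0 < a)
    (hD : HasLaw D (gaussianReal 0 a.toNNReal) P) : MemLp (fun ω => D ω ^ 2 - a) 2 P := by
  have hξ := hasLaw_div_sqrt ha hD
  have h : MemLp (fun x : ℝ => a * (x ^ 2 - 1)) 2 (gaussianReal 0 1) :=
    (memLp_sq_gaussianReal.sub (memLp_const 1)).const_mul a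
  rw [← hξ.map_eq] at h
  have := h.comp_of_map hξ.aemeasurable
  refine (memLp_congr_ae (Eventually.of_forall fun ω => ?_)).1 this
  simp only [Function.comp_apply]
  rw [div_pow, Real.sq_sqrt ha.le]
  field_simp

lemma integral_sq_sub_of_hasLaw_gaussianReal {D : Ω → ℝ} {a : ℝ} (ha : 0 < a)
    (hD : HasLaw D (gaussianReal 0 a.toNNReal) P) [IsProbabilityMeasure P] :
    ∫ ω, (D ω ^ 2 - a) ∂P = 0 := by
  have h0 : ∫ ω, D ω ∂P = 0 := by rw [hD.integral_eq, integral_id_gaussianReal]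
  have h1 : Var[D; P] = a := by
    rw [hD.variance_eq, variance_id_gaussianReal, Real.coe_toNNReal _ ha.le]
  rw [variance_of_integral_eq_zero hD.aemeasurable h0] at h1
  have hi : Integrable (fun ω => D ω ^ 2) P := by
    have := (memLp_sq_sub_of_hasLaw_gaussianReal ha hD).integrable (by norm_num)
    refine (this.add (integrable_const a)).congr (Eventually.of_forall fun ω => ?_)
    simp
  rw [integral_sub hi (integrable_const _), h1]
  simp

end ProbabilityTheory

/-! ### Partial sums of a stationary autoregression -/

namespace ProbabilityTheory

variable {Ω : Type*} [MeasurableSpace Ω] {P : Measure Ω}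

/-- Unrolling the recursion `n` times leaves a remainder that is bounded in `L¹`. -/
lemma exists_eq_pow_mul_add_of_autoregression {X ε : ℤ → Ω → ℝ} {φ E : ℝ} (hφ : |φ| < 1)
    (hX : ∀ i, ∀ᵐ ω ∂P, X i ω = φ * X (i - 1) ω + ε i ω) (hε : ∀ i, Integrable (ε i) P)
    (hE : ∀ i, ∫ ω, |ε i ω| ∂P ≤ E) (n : ℕ) (i : ℤ) :
    ∃ Y : Ω → ℝ, Integrable Y P ∧ ∫ ω, |Y ω| ∂P ≤ E / (1 - |φ|) ∧
      ∀ᵐ ω ∂P, X i ω = φ ^ n * X (i - n) ω + Y ω := by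
  have hE0 : 0 ≤ E := (integral_nonneg fun ω => abs_nonneg (ε 0 ω)).trans (hE 0)
  induction n generalizing i with
  | zero =>
    refine ⟨0, integrable_zero _ _ _, ?_, Eventually.of_forall fun ω => by simp⟩
    simpa using div_nonneg hE0 (by linarith)
  | succ n ih =>
    obtain ⟨Y, hY, hYE, hXY⟩ := ih (i - 1)
    refine ⟨fun ω => φ * Y ω + ε i ω, (hY.const_mul φ).add (hε i), ?_, ?_⟩
    · calc ∫ ω, |φ * Y ω + ε i ω| ∂P ≤ ∫ ω, (|φ| * |Y ω| + |ε i ω|) ∂P := by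
            refine integral_mono ((hY.const_mul φ).add (hε i)).abs
              ((hY.abs.const_mul _).add (hε i).abs) fun ω => ?_
            simp only []
            rw [← abs_mul]
            exact abs_add_le _ _
        _ = |φ| * ∫ ω, |Y ω| ∂P + ∫ ω, |ε i ω| ∂P := by
            rw [integral_add (hY.abs.const_mul _) (hε i).abs, integral_const_mul]
        _ ≤ |φ| * (E / (1 - |φ|)) + E :=
            add_le_add (mul_le_mul_of_nonneg_left hYE (abs_nonneg _)) (hE i)
        _ = E / (1 - |φ|) := by
            have : 1 - |φ| ≠ 0 := by linarith
            field_simp; ring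
    · filter_upwards [hX i, hXY] with ω h1 h2
      have : i - 1 - (n : ℤ) = i - ((n + 1 : ℕ) : ℤ) := by push_cast; ring
      rw [h1, h2, this]
      ring

variable [IsProbabilityMeasure P]

lemma integral_abs_le_sqrt_integral_sq {f : Ω → ℝ} (hf : MemLp f 2 P) :
    ∫ ω, |f ω| ∂P ≤ √(∫ ω, f ω ^ 2 ∂P) := by
  have h := variance_nonneg |f| P
  rw [variance_eq_sub hf.abs] at h
  simp only [Pi.pow_apply, Pi.abs_apply, sq_abs] at h
  exact Real.le_sqrt_of_sq_le (by linarith)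

/-- A stationary solution of an autoregression with integrable innovations is integrable: by
stationarity the term `φ ^ n * X (-n)` tends to zero in probability, and the remainder is bounded
in `L¹`. -/
lemma integrable_of_stationary_autoregression {X ε : ℤ → Ω → ℝ} {φ E : ℝ} (hφ : |φ| < 1)
    (hX : ∀ i, ∀ᵐ ω ∂P, X i ω = φ * X (i - 1) ω + ε i ω) (hε : ∀ i, Integrable (ε i) P)
    (hE : ∀ i, ∫ ω, |ε i ω| ∂P ≤ E) (hst : ∀ i, IdentDistrib (X i) (X 0) P P) :
    Integrable (X 0) P := by
  have hm : ∀ i, AEMeasurable (X i) P := fun i => (hst i).aemeasurable_fst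
  set C := E / (1 - |φ|)
  have hint : ∀ (K : ℕ) (c : ℝ) (i : ℤ), Integrable (fun ω => min |c * X i ω| (K : ℝ)) P :=
    fun K c i => by
      have := hm i
      refine (integrable_const (K : ℝ)).mono'
        (AEMeasurable.aestronglyMeasurable (by fun_prop)) (Eventually.of_forall fun ω => ?_)
      rw [Real.norm_eq_abs, abs_of_nonneg (le_min (abs_nonneg _) (Nat.cast_nonneg _))]
      exact min_le_right _ _
  have hK : ∀ K : ℕ, ∫ ω, min |X 0 ω| (K : ℝ) ∂P ≤ C := fun K => by
    have hlim : Tendsto (fun n : ℕ => ∫ ω, min |φ ^ n * X 0 ω| (K : ℝ) ∂P + C) atTop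
        (𝓝 (∫ _, (0 : ℝ) ∂P + C)) := by
      refine Tendsto.add_const _ (tendsto_integral_of_dominated_convergence (fun _ => (K : ℝ))
        (fun n => (hint K _ 0).aestronglyMeasurable) (integrable_const _)
        (fun n => Eventually.of_forall fun ω => ?_) (Eventually.of_forall fun ω => ?_))
      · rw [Real.norm_eq_abs, abs_of_nonneg (le_min (abs_nonneg _) (Nat.cast_nonneg _))]
        exact min_le_right _ _
      · have h1 := ((tendsto_pow_atTop_nhds_zero_of_abs_lt_one hφ).mul_const (X 0 ω)).abs.min
          (tendsto_const_nhds (x := (K : ℝ)))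
        simpa using h1
    rw [integral_zero, zero_add] at hlim
    refine ge_of_tendsto' hlim fun n => ?_
    obtain ⟨Y, hY, hYE, hXY⟩ := exists_eq_pow_mul_add_of_autoregression hφ hX hε hE n 0
    have hshift : ∫ ω, min |φ ^ n * X 0 ω| (K : ℝ) ∂P
        = ∫ ω, min |φ ^ n * X (0 - n) ω| (K : ℝ) ∂P :=
      ((hst (0 - n)).comp (u := fun x => min |φ ^ n * x| (K : ℝ)) (by fun_prop)).integral_eq.symm
    calc ∫ ω, min |X 0 ω| (K : ℝ) ∂P
        ≤ ∫ ω, (min |φ ^ n * X (0 - n) ω| (K : ℝ) + |Y ω|) ∂P := by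
          refine integral_mono_ae (by simpa using hint K 1 0) ((hint K _ _).add hY.abs) ?_
          filter_upwards [hXY] with ω h
          rw [h]
          have h1 := abs_add_le (φ ^ n * X (0 - n) ω) (Y ω)
          have h2 := abs_nonneg (Y ω)
          rcases le_total |φ ^ n * X (0 - n) ω| (K : ℝ) with h3 | h3
          · rw [min_eq_left h3]
            exact (min_le_left _ _).trans h1
          · rw [min_eq_right h3]
            exact (min_le_right _ _).trans (by linarith)
      _ ≤ _ := by
          rw [integral_add (hint K _ _) hY.abs, hshift]
          exact add_le_add_right hYE _
  refine ⟨(hm 0).aestronglyMeasurable, ?_⟩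
  have hmono : Tendsto (fun K : ℕ => ∫⁻ ω, ENNReal.ofReal (min |X 0 ω| (K : ℝ)) ∂P) atTop
      (𝓝 (∫⁻ ω, ‖X 0 ω‖ₑ ∂P)) := by
    have := hm 0
    refine lintegral_tendsto_of_tendsto_of_monotone (fun K => by fun_prop)
      (Eventually.of_forall fun ω K L hKL => ENNReal.ofReal_le_ofReal
        (min_le_min_left _ (by exact_mod_cast hKL))) (Eventually.of_forall fun ω => ?_)
    refine tendsto_const_nhds.congr' ?_
    filter_upwards [eventually_ge_atTop ⌈|X 0 ω|⌉₊] with K hKω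
    rw [min_eq_left ((Nat.le_ceil _).trans (by exact_mod_cast hKω)), ← Real.norm_eq_abs,
      ofReal_norm]
  refine lt_of_le_of_lt (le_of_tendsto' hmono fun K => ?_) (ENNReal.ofReal_lt_top (r := C))
  have := hint K 1 0
  simp only [one_mul] at this
  rw [← ofReal_integral_eq_lintegral_ofReal this
    (Eventually.of_forall fun ω => le_min (abs_nonneg _) (Nat.cast_nonneg _))]
  exact ENNReal.ofReal_le_ofReal (hK K)

/-- The partial sums of a stationary autoregression are of order `√N`: summing the recursion
expresses them through the partial sums of the innovations and two boundary terms. -/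
theorem exists_integral_abs_sum_autoregression_le {X ε : ℤ → Ω → ℝ} {φ : ℝ} (hφ : |φ| < 1)
    (hX : ∀ i, ∀ᵐ ω ∂P, X i ω = φ * X (i - 1) ω + ε i ω) (hind : iIndepFun ε P)
    (hid : ∀ i, IdentDistrib (ε i) (ε 0) P P) (hε : MemLp (ε 0) 2 P)
    (h0 : ∫ ω, ε 0 ω ∂P = 0) (hst : ∀ i, IdentDistrib (X i) (X 0) P P) :
    (∀ i, Integrable (X i) P) ∧ ∃ C : ℝ, 0 ≤ C ∧ ∀ N : ℕ, 1 ≤ N →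
      ∫ ω, |∑ i ∈ Finset.Icc 1 N, X (i : ℤ) ω| ∂P ≤ C * √N := by
  have hεL : ∀ i, MemLp (ε i) 2 P := fun i => (hid i).memLp_iff.2 hε
  have hεi : ∀ i, Integrable (ε i) P := fun i => (hεL i).integrable (by norm_num)
  have habs : ∀ i, ∫ ω, |ε i ω| ∂P ≤ ∫ ω, |ε 0 ω| ∂P := fun i =>
    ((hid i).comp (u := fun x : ℝ => |x|) (by fun_prop)).integral_eq.le
  have hX0 := integrable_of_stationary_autoregression hφ hX hεi habs hst
  have hXi : ∀ i, Integrable (X i) P := fun i => (hst i).integrable_iff.2 hX0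
  have hXabs : ∀ i, ∫ ω, |X i ω| ∂P = ∫ ω, |X 0 ω| ∂P := fun i =>
    ((hst i).comp (u := fun x : ℝ => |x|) (by fun_prop)).integral_eq
  have hφ1 : 0 < 1 - φ := by linarith [(abs_lt.1 hφ).2]
  set A := ∫ ω, |X 0 ω| ∂P with hA
  set V := ∫ ω, ε 0 ω ^ 2 ∂P with hV
  have hA0 : 0 ≤ A := integral_nonneg fun ω => abs_nonneg _
  refine ⟨hXi, (2 * |φ| * A + √V) / (1 - φ), by positivity, fun N hN => ?_⟩
  have hsum : ∀ᵐ ω ∂P, (1 - φ) * ∑ i ∈ Finset.Icc 1 N, X (i : ℤ) ω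
      = φ * (X 0 ω - X N ω) + ∑ i ∈ Finset.Icc 1 N, ε (i : ℤ) ω := by
    filter_upwards [ae_all_iff.2 hX] with ω hω
    clear hN
    induction N with
    | zero => simp
    | succ N ih =>
      rw [Finset.sum_Icc_succ_top (by omega), Finset.sum_Icc_succ_top (by omega), mul_add, ih]
      have := hω ((N + 1 : ℕ) : ℤ)
      have h1 : ((N + 1 : ℕ) : ℤ) - 1 = N := by push_cast; ring
      rw [h1] at this
      rw [this]
      ring
  have hεsum : ∫ ω, |∑ i ∈ Finset.Icc 1 N, ε (i : ℤ) ω| ∂P ≤ √V * √N := by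
    refine (integral_abs_le_sqrt_integral_sq
      (memLp_finsetSum (f := fun (i : ℕ) => ε (i : ℤ)) _ fun i _ => hεL i)).trans (le_of_eq ?_)
    have hsq : ∀ i : ℤ, ∫ ω, ε i ω ^ 2 ∂P = V := fun i =>
      ((hid i).comp (u := fun x : ℝ => x ^ 2) (by fun_prop)).integral_eq
    have hind' : iIndepFun (fun i : ℕ => ε (i : ℤ)) P := hind.precomp Nat.cast_injective
    rw [hind'.integral_sq_sum (fun i => hεL i)
      (fun i => by rw [(hid i).integral_eq, h0]) (Finset.Icc 1 N)]
    simp only [hsq, Finset.sum_const, Nat.card_Icc, add_tsub_cancel_right,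
      nsmul_eq_mul]
    rw [mul_comm, Real.sqrt_mul (integral_nonneg fun ω => sq_nonneg _)]
  have hI1 : Integrable (fun ω => ∑ i ∈ Finset.Icc 1 N, ε (i : ℤ) ω) P :=
    integrable_finsetSum _ fun i _ => hεi _
  have hI2 : Integrable (fun ω => φ * (X 0 ω - X N ω)) P := ((hXi 0).sub (hXi N)).const_mul φ
  have hN1 : 1 ≤ √(N : ℝ) := by
    rw [Real.one_le_sqrt]; exact_mod_cast hN
  have hmain : (1 - φ) * ∫ ω, |∑ i ∈ Finset.Icc 1 N, X (i : ℤ) ω| ∂P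
      ≤ 2 * |φ| * A + √V * √N := by
    calc (1 - φ) * ∫ ω, |∑ i ∈ Finset.Icc 1 N, X (i : ℤ) ω| ∂P
        = ∫ ω, |φ * (X 0 ω - X N ω) + ∑ i ∈ Finset.Icc 1 N, ε (i : ℤ) ω| ∂P := by
          rw [← integral_const_mul]
          refine integral_congr_ae ?_
          filter_upwards [hsum] with ω h
          rw [← h, abs_mul, abs_of_pos hφ1]
      _ ≤ ∫ ω, (|φ| * (|X 0 ω| + |X N ω|) + |∑ i ∈ Finset.Icc 1 N, ε (i : ℤ) ω|) ∂P := by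
          refine integral_mono (hI2.add hI1).abs
            ((((hXi 0).abs.add (hXi N).abs).const_mul _).add hI1.abs) fun ω => ?_
          refine (abs_add_le _ _).trans (add_le_add_left ?_ _)
          rw [abs_mul]
          exact mul_le_mul_of_nonneg_left (abs_sub _ _) (abs_nonneg _)
      _ = |φ| * (A + A) + ∫ ω, |∑ i ∈ Finset.Icc 1 N, ε (i : ℤ) ω| ∂P := by
          have h1 : Integrable (fun ω => |φ| * (|X 0 ω| + |X N ω|)) P :=
            ((hXi 0).abs.add (hXi N).abs).const_mul _
          rw [integral_add h1 hI1.abs, integral_const_mul,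
            integral_add (hXi 0).abs (hXi N).abs, hXabs N]
      _ ≤ _ := by linarith
  rw [div_mul_eq_mul_div, le_div_iff₀ hφ1, mul_comm]
  refine hmain.trans ?_
  have : 0 ≤ 2 * |φ| * A := by positivity
  nlinarith

end ProbabilityTheory

/-! ### Realized volatility on a grid -/

lemma abs_log_le_of_mem_Icc {a b x : ℝ} (ha : 0 < a) (hx : x ∈ Icc a b) :
    |Real.log x| ≤ |Real.log a| + |Real.log b| := by
  have h1 := Real.log_le_log ha hx.1
  have h2 := Real.log_le_log (ha.trans_le hx.1) hx.2
  rw [abs_le]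
  constructor
  · linarith [neg_abs_le (Real.log a), abs_nonneg (Real.log b)]
  · linarith [le_abs_self (Real.log b), abs_nonneg (Real.log a)]

/-- The logarithms of two positive numbers at distance at most `y`, one of which is at least `2c`.
If `y ≤ c`, the mean value theorem applies; otherwise `1 ≤ y / c`, and crude bounds on the two
logarithms suffice. -/
lemma abs_log_sub_log_le {c s s₁ s₂ q q₂ y : ℝ} (hc : 0 < c) (hs₁ : 0 < s₁)
    (hs : s ∈ Icc s₁ s₂) (hq : q ∈ Icc (2 * c) q₂) (hy : |s - q| ≤ y) :
    |Real.log s - Real.log q| ≤ y / c *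
      ((1 + (|Real.log (2 * c)| + |Real.log q₂|)) + |Real.log s₁| + |Real.log s₂|) := by
  have hspos : 0 < s := hs₁.trans_le hs.1
  have hqpos : 0 < q := by linarith [hq.1]
  have hy0 : 0 ≤ y := (abs_nonneg _).trans hy
  set L := (|Real.log (2 * c)| + |Real.log q₂|) + |Real.log s₁| + |Real.log s₂| with hL
  have hL0 : 0 ≤ L := by positivity
  have hL1 : (1 + (|Real.log (2 * c)| + |Real.log q₂|)) + |Real.log s₁| + |Real.log s₂|
      = 1 + L := by rw [hL]; ring
  rw [hL1]
  rcases le_total y c with h | h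
  · have h1 := abs_le.1 hy
    have hsc : c ≤ s := by linarith [hq.1]
    have key : ∀ {a b : ℝ}, 0 < a → c ≤ b → a - b ≤ y → Real.log a - Real.log b ≤ y / c := by
      intro a b ha hb hab
      have hb0 : 0 < b := hc.trans_le hb
      rw [← Real.log_div ha.ne' hb0.ne']
      refine (Real.log_le_sub_one_of_pos (div_pos ha hb0)).trans ?_
      calc a / b - 1 = (a - b) / b := by field_simp
        _ ≤ y / b := by gcongr
        _ ≤ y / c := by gcongr
    have h2 := key hspos (by linarith [hq.1] : c ≤ q) (by linarith)
    have h3 := key hqpos hsc (by linarith)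
    have h4 : 0 ≤ y / c := by positivity
    rw [abs_le]
    constructor <;> nlinarith
  · have h1 : 1 ≤ y / c := (one_le_div hc).2 h
    have h2 := abs_log_le_of_mem_Icc hs₁ hs
    have h3 := abs_log_le_of_mem_Icc (by positivity) hq
    calc |Real.log s - Real.log q| ≤ |Real.log s| + |Real.log q| := abs_sub _ _
      _ ≤ L := by linarith
      _ ≤ 1 * (1 + L) := by linarith
      _ ≤ _ := by gcongr

lemma MeasureTheory.MemLp.integral_sq_eq_toReal_eLpNorm_sq {Ω : Type*} [MeasurableSpace Ω]
    {P : Measure Ω} {f : Ω → ℝ} (hf : MemLp f 2 P) :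
    ∫ ω, f ω ^ 2 ∂P = (eLpNorm f 2 P).toReal ^ 2 := by
  rw [← Lp.norm_toLp f hf, ← real_inner_self_eq_norm_sq, Lp.inner_toLp]
  simp [pow_two]

namespace FSV

/-- The volatility functions that the model allows: measurable, nonnegative, bounded by `K`, and
almost everywhere nonzero on `[0, 1]`. -/
structure IsVolatility (σ : ℝ → ℝ) (K : ℝ) : Prop where
  measurable : Measurable ((Icc (0 : ℝ) 1).domRestrict σ)
  nonneg : ∀ t ∈ Icc (0 : ℝ) 1, 0 ≤ σ t
  le : ∀ t ∈ Icc (0 : ℝ) 1, σ t ≤ K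
  ne_zero : ∀ᵐ t ∂(volume.restrict (Icc (0 : ℝ) 1)), σ t ≠ 0

namespace IsVolatility

variable {σ : ℝ → ℝ} {K : ℝ} (hσ : IsVolatility σ K)
include hσ

lemma memLp_indicator {t : ℝ≥0} (ht : t ≤ 1) :
    MemLp ((Icc (0 : ℝ) t).indicator σ) 2 volume := by
  have hsub : Icc (0 : ℝ) t ⊆ Icc 0 1 := Icc_subset_Icc_right (by exact_mod_cast ht)
  have hm : AEMeasurable σ (volume.restrict (Icc (0 : ℝ) 1)) :=
    (aemeasurable_restrict_iff_comap_subtype measurableSet_Icc).2 hσ.measurable.aemeasurable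
  rw [memLp_indicator_iff_restrict measurableSet_Icc]
  refine MemLp.of_bound (hm.mono_measure (Measure.restrict_mono hsub le_rfl)).aestronglyMeasurable
    K ?_
  filter_upwards [ae_restrict_mem measurableSet_Icc] with u hu
  rw [Real.norm_eq_abs, abs_of_nonneg (hσ.nonneg u (hsub hu))]
  exact hσ.le u (hsub hu)

lemma integrableOn_sq : IntegrableOn (fun u => σ u ^ 2) (Icc 0 1) := by
  have h := (hσ.memLp_indicator le_rfl)
  rw [memLp_indicator_iff_restrict measurableSet_Icc] at h
  have h2 := h.integrable_sq
  simp only [NNReal.coe_one] at h2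
  exact h2

lemma intervalIntegrable_sq {s t : ℝ} (hs : s ∈ Icc (0 : ℝ) 1) (ht : t ∈ Icc (0 : ℝ) 1) :
    IntervalIntegrable (fun u => σ u ^ 2) volume s t :=
  (hσ.integrableOn_sq.mono_set (uIcc_subset_Icc hs ht)).intervalIntegrable

lemma G_sub {s t : ℝ} (hs : s ∈ Icc (0 : ℝ) 1) (ht : t ∈ Icc (0 : ℝ) 1) :
    G σ t - G σ s = ∫ u in s..t, σ u ^ 2 := by
  have h0 : (0 : ℝ) ∈ Icc (0 : ℝ) 1 := by simp
  exact intervalIntegral.integral_interval_sub_left (hσ.intervalIntegrable_sq h0 ht)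
    (hσ.intervalIntegrable_sq h0 hs)

lemma G_strictMonoOn : StrictMonoOn (G σ) (Icc 0 1) := by
  intro s hs t ht hst
  rw [← sub_pos, hσ.G_sub hs ht]
  refine (intervalIntegral.integral_pos_iff_support_of_nonneg_ae
    (Eventually.of_forall fun u => sq_nonneg _) (hσ.intervalIntegrable_sq hs ht)).2 ⟨hst, ?_⟩
  have hsub : Ioc s t ⊆ Icc (0 : ℝ) 1 := fun u hu => ⟨hs.1.trans hu.1.le, hu.2.trans ht.2⟩
  have hne := hσ.ne_zero
  rw [ae_restrict_iff' measurableSet_Icc] at hne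
  have hle : volume (Ioc s t) ≤ volume (Function.support (fun u => σ u ^ 2) ∩ Ioc s t) := by
    refine measure_mono_ae ?_
    filter_upwards [hne] with u hu hmem
    exact ⟨by simpa using hu (hsub hmem), hmem⟩
  refine lt_of_lt_of_le ?_ hle
  simpa using hst

lemma G_sub_le {s t : ℝ} (hs : s ∈ Icc (0 : ℝ) 1) (ht : t ∈ Icc (0 : ℝ) 1) (hst : s ≤ t) :
    G σ t - G σ s ≤ K ^ 2 * (t - s) := by
  rw [hσ.G_sub hs ht]
  calc ∫ u in s..t, σ u ^ 2 ≤ ∫ _ in s..t, K ^ 2 := by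
        refine intervalIntegral.integral_mono_on hst (hσ.intervalIntegrable_sq hs ht)
          intervalIntegrable_const fun u hu => ?_
        have hu1 : u ∈ Icc (0 : ℝ) 1 := ⟨hs.1.trans hu.1, hu.2.trans ht.2⟩
        exact pow_le_pow_left₀ (hσ.nonneg u hu1) (hσ.le u hu1) 2
    _ = K ^ 2 * (t - s) := by simp [mul_comm]

lemma G_pos {t : ℝ} (ht : t ∈ Ioc (0 : ℝ) 1) : 0 < G σ t := by
  have := hσ.G_strictMonoOn (by simp : (0 : ℝ) ∈ Icc (0 : ℝ) 1) ⟨ht.1.le, ht.2⟩ ht.1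
  simpa [G] using this

end IsVolatility

lemma coe_gridPt (m k : ℕ) : ((gridPt m k : ℝ≥0) : ℝ) = k / m := by
  simp [gridPt]

/-- The design points up to `t` are those with index at most `⌊t m⌋`. -/
lemma sum_range_ite_gridPt_le {m : ℕ} (hm : 0 < m) {t : ℝ} (ht : t ∈ Icc (0 : ℝ) 1) (x : ℕ → ℝ) :
    ∑ k ∈ Finset.range m, (if (gridPt m (k + 1) : ℝ) ≤ t then x k else 0)
      = ∑ k ∈ Finset.range ⌊t * m⌋₊, x k := by
  have hm' : (0 : ℝ) < m := by exact_mod_cast hm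
  have hle : ⌊t * m⌋₊ ≤ m := by
    refine Nat.floor_le_of_le ?_
    nlinarith [ht.2]
  rw [← Finset.sum_filter]
  refine Finset.sum_congr ?_ fun _ _ => rfl
  ext k
  have : (gridPt m (k + 1) : ℝ) ≤ t ↔ k < ⌊t * m⌋₊ := by
    rw [coe_gridPt, div_le_iff₀ hm', ← Nat.succ_le_iff, Nat.le_floor_iff (by nlinarith [ht.1])]
  simp only [Finset.mem_filter, Finset.mem_range, this]
  omega

variable {Ω : Type*} [MeasurableSpace Ω] {P : Measure Ω} [IsProbabilityMeasure P]

/-- The increments of the Itô integral over the grid are independent centered Gaussian variables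
with variances `G t_{k+1} - G t_k`. The index is truncated at `m`, where the grid ends. -/
lemma IsVolatility.iIndepFun_increments {σ : ℝ → ℝ} {K : ℝ} (hσ : IsVolatility σ K) {m : ℕ}
    (hm : 0 < m) {B : ℝ≥0 → Ω → ℝ} (hB : IsPreBrownianReal B P) {I : ℕ → Ω → ℝ}
    (hI : ∀ k ≤ m, IsItoIntegral P B σ (gridPt m k) (I k)) :
    iIndepFun (fun k ω => I (min (k + 1) m) ω - I (min k m) ω) P ∧
      ∀ k < m, HasLaw (fun ω => I (k + 1) ω - I k ω)
        (gaussianReal 0 (G σ ((k + 1 : ℕ) / m) - G σ (k / m)).toNNReal) P := by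
  have hle : ∀ k ≤ m, gridPt m k ≤ 1 := fun k hk => by
    rw [← NNReal.coe_le_coe, coe_gridPt, NNReal.coe_one]
    exact div_le_one_of_le₀ (by exact_mod_cast hk) (Nat.cast_nonneg _)
  obtain ⟨hG, h0, hcov⟩ := IsItoIntegral.isGaussianProcess (τ := fun k => gridPt m (min k m))
    (I := fun k => I (min k m)) hB (fun k => hI _ (min_le_right _ _))
    (fun k => hσ.memLp_indicator (hle _ (min_le_right _ _)))
  have hV : ∀ j k, ∫ ω, I (min j m) ω * I (min k m) ω ∂P
      = (fun k : ℕ => G σ ((min k m : ℕ) / m)) (min j k) := fun j k => by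
    rw [hcov, coe_gridPt, coe_gridPt]
    have : min (((min j m : ℕ) : ℝ) / m) (((min k m : ℕ) : ℝ) / m)
        = ((min (min j k) m : ℕ) : ℝ) / m := by
      rw [min_div_div_right (Nat.cast_nonneg _), ← Nat.cast_min]
      congr 2
      omega
    simp only [G]
    rw [this, integral_Icc_eq_integral_Ioc, intervalIntegral.integral_of_le (by positivity)]
  obtain ⟨h1, h2⟩ := hG.iIndepFun_increments
    (V := fun k : ℕ => G σ ((min k m : ℕ) / m)) h0 hV
  refine ⟨h1, fun k hk => ?_⟩
  have := h2 k
  simpa only [min_eq_left hk.le, min_eq_left (Nat.succ_le_of_lt hk)] using this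

end FSV

/-! ### A uniform bound for the logarithm of realized volatility -/

namespace FSV

lemma natCast_div_mem_Icc {m k : ℕ} (hk : k ≤ m) : (k : ℝ) / m ∈ Icc (0 : ℝ) 1 :=
  ⟨by positivity, div_le_one_of_le₀ (by exact_mod_cast hk) (Nat.cast_nonneg _)⟩

lemma sum_G_increments (σ : ℝ → ℝ) (m n : ℕ) :
    ∑ k ∈ Finset.range n, (G σ ((k + 1 : ℕ) / m) - G σ (k / m)) = G σ (n / m) := by
  rw [Finset.sum_range_sub (fun k : ℕ => G σ (k / m))]
  simp [G]

namespace IsVolatility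

variable {Ω : Type*} [MeasurableSpace Ω] {P : Measure Ω} [IsProbabilityMeasure P]
  {σ : ℝ → ℝ} {K : ℝ}

lemma G_increment_pos (hσ : IsVolatility σ K) {m k : ℕ} (hk : k < m) :
    0 < G σ ((k + 1 : ℕ) / m) - G σ (k / m) := by
  have hm : (0 : ℝ) < m := by exact_mod_cast (Nat.zero_le k).trans_lt hk
  refine sub_pos.2 (hσ.G_strictMonoOn (natCast_div_mem_Icc hk.le) (natCast_div_mem_Icc hk) ?_)
  gcongr
  exact k.lt_succ_self

lemma G_increment_le (hσ : IsVolatility σ K) {m k : ℕ} (hk : k < m) :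
    G σ ((k + 1 : ℕ) / m) - G σ (k / m) ≤ K ^ 2 / m := by
  have hm : (0 : ℝ) < m := by exact_mod_cast (Nat.zero_le k).trans_lt hk
  have h := hσ.G_sub_le (natCast_div_mem_Icc hk.le) (natCast_div_mem_Icc (m := m) hk)
    (by gcongr; exact k.le_succ)
  refine h.trans (le_of_eq ?_)
  push_cast
  field_simp
  ring

/-- Realized volatility deviates from the cumulative volatility on the grid by `O(Δ^{1/2})` in
`L²`, uniformly over the grid. -/
lemma integral_sq_partialSups_le (hσ : IsVolatility σ K) {m : ℕ} (hm : 0 < m)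
    {B : ℝ≥0 → Ω → ℝ} (hB : IsPreBrownianReal B P) {I : ℕ → Ω → ℝ}
    (hI : ∀ k ≤ m, IsItoIntegral P B σ (gridPt m k) (I k)) :
    ∃ Y : Ω → ℝ, MemLp Y 2 P ∧
      ∫ ω, Y ω ^ 2 ∂P ≤
        4 * (∫ x, (x ^ 2 - 1) ^ 2 ∂(gaussianReal 0 1)) * K ^ 2 * G σ 1 / m ∧
      ∀ ω, ∀ n ≤ m, |∑ k ∈ Finset.range n, (I (k + 1) ω - I k ω) ^ 2 - G σ (n / m)| ≤ Y ω := by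
  obtain ⟨hind, hlaw⟩ := hσ.iIndepFun_increments hm hB hI
  set κ := ∫ x, (x ^ 2 - 1) ^ 2 ∂(gaussianReal 0 1)
  have hκ : 0 ≤ κ := integral_nonneg fun x => sq_nonneg _
  set a : ℕ → ℝ := fun k => G σ ((min (k + 1) m : ℕ) / m) - G σ ((min k m : ℕ) / m) with ha
  set ξ : ℕ → Ω → ℝ := fun k ω => (I (min (k + 1) m) ω - I (min k m) ω) ^ 2 - a k with hξ
  have hlt : ∀ k < m, ξ k = (fun ω => (I (k + 1) ω - I k ω) ^ 2
      - (G σ ((k + 1 : ℕ) / m) - G σ (k / m))) := fun k hk => by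
    simp only [hξ, ha]
    rw [min_eq_left hk.le, min_eq_left (Nat.succ_le_of_lt hk)]
  have hge : ∀ k, m ≤ k → ξ k = 0 := fun k hk => by
    funext ω
    simp only [hξ, ha]
    rw [min_eq_right hk, min_eq_right (by omega)]
    simp
  have hξind : iIndepFun ξ P := hind.comp (fun k x => x ^ 2 - a k) fun k => by fun_prop
  have hξL : ∀ k, MemLp (ξ k) 2 P := fun k => by
    rcases lt_or_ge k m with hk | hk
    · rw [hlt k hk]
      exact memLp_sq_sub_of_hasLaw_gaussianReal (hσ.G_increment_pos hk) (hlaw k hk)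
    · rw [hge k hk]; exact MemLp.zero
  have hξ0 : ∀ k, ∫ ω, ξ k ω ∂P = 0 := fun k => by
    rcases lt_or_ge k m with hk | hk
    · rw [hlt k hk]
      exact integral_sq_sub_of_hasLaw_gaussianReal (hσ.G_increment_pos hk) (hlaw k hk)
    · rw [hge k hk]; simp
  refine ⟨fun ω => partialSups (fun j => |∑ i ∈ Finset.range j, ξ i ω|) m,
    memLp_partialSups_abs_sum hξL m, ?_, fun ω n hn => ?_⟩
  · refine (hξind.integral_sq_partialSups_le hξL hξ0 m).trans ?_
    have hterm : ∀ k ∈ Finset.range m, ∫ ω, ξ k ω ^ 2 ∂P ≤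
        κ * (K ^ 2 / m) * (G σ ((k + 1 : ℕ) / m) - G σ (k / m)) := fun k hk => by
      have hk := Finset.mem_range.1 hk
      rw [hlt k hk, integral_sq_sub_sq_of_hasLaw_gaussianReal (hσ.G_increment_pos hk) (hlaw k hk)]
      have h1 := hσ.G_increment_pos hk
      have h2 := hσ.G_increment_le hk
      calc _ = κ * (G σ ((k + 1 : ℕ) / m) - G σ (k / m)) *
            (G σ ((k + 1 : ℕ) / m) - G σ (k / m)) := by ring
        _ ≤ _ := by gcongr
    calc _ ≤ 4 * ∑ k ∈ Finset.range m,
            κ * (K ^ 2 / m) * (G σ ((k + 1 : ℕ) / m) - G σ (k / m)) := by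
          gcongr with k hk; exact hterm k hk
      _ = _ := by
          rw [← Finset.mul_sum, sum_G_increments, div_self (by exact_mod_cast hm.ne')]
          ring
  · have h1 := le_partialSups_of_le (fun j => |∑ i ∈ Finset.range j, ξ i ω|) hn
    refine le_trans (le_of_eq ?_) h1
    congr 1
    rw [← sum_G_increments σ m n, ← Finset.sum_sub_distrib]
    refine Finset.sum_congr rfl fun k hk => ?_
    rw [hlt k (by have := Finset.mem_range.1 hk; omega)]

/-- The logarithm of realized volatility at a grid point away from zero is bounded in `L²`. -/
lemma integral_sq_log_sum_le (hσ : IsVolatility σ K) {m : ℕ} (hm : 0 < m)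
    {B : ℝ≥0 → Ω → ℝ} (hB : IsPreBrownianReal B P) {I : ℕ → Ω → ℝ}
    (hI : ∀ k ≤ m, IsItoIntegral P B σ (gridPt m k) (I k)) {β : ℝ} (hβ : 0 < β) {n : ℕ}
    (hn : n ≤ m) (hβn : β ≤ n / m) :
    MemLp (fun ω => Real.log (∑ k ∈ Finset.range n, (I (k + 1) ω - I k ω) ^ 2)) 2 P ∧
    ∫ ω, Real.log (∑ k ∈ Finset.range n, (I (k + 1) ω - I k ω) ^ 2) ^ 2 ∂P ≤
      (|Real.log (G σ β)| + |Real.log (G σ 1)| +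
        (eLpNorm logSqMajorant 2 (gaussianReal 0 1)).toReal) ^ 2 := by
  obtain ⟨-, hlaw⟩ := hσ.iIndepFun_increments hm hB hI
  have hlt : ∀ k ∈ Finset.range n, k < m := fun k hk => (Finset.mem_range.1 hk).trans_le hn
  have hn0 : 0 < n := by
    rcases Nat.eq_zero_or_pos n with h | h
    · rw [h] at hβn; simp at hβn; linarith
    · exact h
  have hbound := eLpNorm_log_sum_sq_le (P := P) (s := Finset.range n) ⟨0, by simpa using hn0⟩
    (fun k hk => hσ.G_increment_pos (hlt k hk)) (fun k hk => hlaw k (hlt k hk))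
  rw [sum_G_increments] at hbound
  have hΨ : eLpNorm logSqMajorant 2 (gaussianReal 0 1) ≠ ∞ := memLp_logSqMajorant.eLpNorm_ne_top
  have hfin : ENNReal.ofReal |Real.log (G σ (n / m))| +
      eLpNorm logSqMajorant 2 (gaussianReal 0 1) ≠ ∞ :=
    ENNReal.add_ne_top.2 ⟨ENNReal.ofReal_ne_top, hΨ⟩
  have hmeas : AEMeasurable (fun ω =>
      Real.log (∑ k ∈ Finset.range n, (I (k + 1) ω - I k ω) ^ 2)) P :=
    Real.measurable_log.comp_aemeasurable (Finset.aemeasurable_fun_sum _ fun k hk =>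
      (hlaw k (hlt k hk)).aemeasurable.pow_const 2)
  have hL : MemLp (fun ω => Real.log (∑ k ∈ Finset.range n, (I (k + 1) ω - I k ω) ^ 2)) 2 P :=
    ⟨hmeas.aestronglyMeasurable, hbound.trans_lt hfin.lt_top⟩
  refine ⟨hL, ?_⟩
  rw [hL.integral_sq_eq_toReal_eLpNorm_sq]
  refine pow_le_pow_left₀ ENNReal.toReal_nonneg ?_ 2
  refine (ENNReal.toReal_mono hfin hbound).trans ?_
  rw [ENNReal.toReal_add ENNReal.ofReal_ne_top hΨ, ENNReal.toReal_ofReal (abs_nonneg _)]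
  have hn1 := natCast_div_mem_Icc hn
  have hβ1 : β ∈ Icc (0 : ℝ) 1 := ⟨hβ.le, hβn.trans hn1.2⟩
  refine add_le_add_left (abs_log_le_of_mem_Icc (hσ.G_pos ⟨hβ, hβ1.2⟩) ⟨?_, ?_⟩) _
  · exact hσ.G_strictMonoOn.monotoneOn hβ1 hn1 hβn
  · exact hσ.G_strictMonoOn.monotoneOn hn1 (by simp) hn1.2

/-- The logarithm of realized volatility deviates from that of the cumulative volatility by
`O(Δ^{1/2})` in mean, uniformly on `[α, 1]`; the constant depends on `σ` and `α` only. -/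
theorem exists_majorant (hσ : IsVolatility σ K) {α : ℝ} (hα : α ∈ Ioo (0 : ℝ) 1) :
    ∃ C : ℝ, ∀ m : ℕ, 2 / α ≤ m → ∀ {B : ℝ≥0 → Ω → ℝ}, IsPreBrownianReal B P →
      ∀ {I : ℕ → Ω → ℝ}, (∀ k ≤ m, IsItoIntegral P B σ (gridPt m k) (I k)) →
      ∃ U : Ω → ℝ, Integrable U P ∧ ∫ ω, U ω ∂P ≤ C * √(1 / m) ∧
        ∀ᵐ ω ∂P, ∀ t ∈ Icc α 1,
          0 < ∑ k ∈ Finset.range m,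
            (if (gridPt m (k + 1) : ℝ) ≤ t then (I (k + 1) ω - I k ω) ^ 2 else 0) ∧
          |Real.log (∑ k ∈ Finset.range m,
            (if (gridPt m (k + 1) : ℝ) ≤ t then (I (k + 1) ω - I k ω) ^ 2 else 0)) - H σ t|
            ≤ U ω := by
  have hα1 : α ∈ Icc (0 : ℝ) 1 := ⟨hα.1.le, hα.2.le⟩
  -- `G ≥ 2c` on `[α, 1]`.
  set c := G σ α / 2 with hc
  have hc0 : 0 < c := half_pos (hσ.G_pos ⟨hα.1, hα.2.le⟩)
  set L := |Real.log (2 * c)| + |Real.log (G σ 1)| with hL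
  set κ := ∫ x, (x ^ 2 - 1) ^ 2 ∂(gaussianReal 0 1) with hκ
  set Λ := |Real.log (G σ (α / 2))| + |Real.log (G σ 1)| +
    (eLpNorm logSqMajorant 2 (gaussianReal 0 1)).toReal with hΛ
  set C₁ := 8 * κ * K ^ 2 * G σ 1 + 2 * (K ^ 2) ^ 2 with hC₁
  set C₂ := 3 * ((1 + L) ^ 2 + Λ ^ 2 + Λ ^ 2) with hC₂
  refine ⟨(C₁ + C₂) / (2 * c), fun m hm B hB I hI => ?_⟩
  have hmα : 2 ≤ m * α := by rwa [div_le_iff₀ hα.1] at hm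
  have hm0 : 0 < m := by
    rcases Nat.eq_zero_or_pos m with h | h
    · rw [h] at hmα; norm_num at hmα
    · exact h
  have hm0' : (0 : ℝ) < m := by exact_mod_cast hm0
  have hm1 : (1 : ℝ) ≤ m := by exact_mod_cast hm0
  obtain ⟨Y, hYL, hYint, hY⟩ := hσ.integral_sq_partialSups_le hm0 hB hI
  set S : ℕ → Ω → ℝ := fun n ω => ∑ k ∈ Finset.range n, (I (k + 1) ω - I k ω) ^ 2 with hS
  set n₀ := ⌊α * m⌋₊ with hn₀
  have hfloor : ∀ t ∈ Icc α 1, ⌊t * m⌋₊ ≤ m ∧ n₀ ≤ ⌊t * m⌋₊ ∧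
      ((⌊t * m⌋₊ : ℕ) : ℝ) / m ≤ t ∧ t ≤ ((⌊t * m⌋₊ : ℕ) : ℝ) / m + 1 / m := fun t ht => by
    refine ⟨Nat.floor_le_of_le (by nlinarith [ht.2]), ?_, ?_, ?_⟩
    · exact Nat.floor_le_floor (by have := ht.1; gcongr)
    · rw [div_le_iff₀ hm0']
      exact Nat.floor_le (mul_nonneg (hα.1.le.trans ht.1) hm0'.le)
    · rw [← add_div, le_div_iff₀ hm0']
      exact (Nat.lt_floor_add_one _).le
  have hn₀m : n₀ ≤ m := (hfloor α ⟨le_rfl, hα.2.le⟩).1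
  -- As `2 / m ≤ α`, the last design point before `α` is at least `α / 2`; in particular it is not
  -- zero, so that realized volatility on `[α, 1]` contains at least one increment.
  have hn₀α : α / 2 ≤ (n₀ : ℝ) / m := by
    have h1 := (hfloor α ⟨le_rfl, hα.2.le⟩).2.2.2
    have h2 : 1 / (m : ℝ) ≤ α / 2 := by
      rw [div_le_div_iff₀ hm0' two_pos]; linarith
    linarith
  have hn₀pos : 0 < n₀ := by
    have h1 : 0 < (n₀ : ℝ) / m := (half_pos hα.1).trans_le hn₀α
    rcases Nat.eq_zero_or_pos n₀ with h | h
    · rw [h] at h1; simp at h1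
    · exact h
  obtain ⟨hAL, hAint⟩ : MemLp (fun ω => Real.log (S n₀ ω)) 2 P ∧
      ∫ ω, Real.log (S n₀ ω) ^ 2 ∂P ≤ Λ ^ 2 :=
    hσ.integral_sq_log_sum_le hm0 hB hI (half_pos hα.1) hn₀m hn₀α
  obtain ⟨hBL, hBint⟩ : MemLp (fun ω => Real.log (S m ω)) 2 P ∧
      ∫ ω, Real.log (S m ω) ^ 2 ∂P ≤ Λ ^ 2 :=
    hσ.integral_sq_log_sum_le hm0 hB hI (half_pos hα.1) le_rfl
    (by rw [div_self hm0'.ne']; linarith [hα.2, hα.1] : α / 2 ≤ (m : ℝ) / m)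
  set Y' : Ω → ℝ := fun ω => Y ω + K ^ 2 / m with hY'
  set Z : Ω → ℝ := fun ω => (1 + L) + |Real.log (S n₀ ω)| + |Real.log (S m ω)| with hZ
  have hY'L : MemLp Y' 2 P := hYL.add (memLp_const _)
  have hZL : MemLp Z 2 P := ((memLp_const (1 + L)).add hAL.abs).add hBL.abs
  have hY'int : ∫ ω, Y' ω ^ 2 ∂P ≤ C₁ / m := by
    calc ∫ ω, Y' ω ^ 2 ∂P ≤ ∫ ω, (2 * Y ω ^ 2 + 2 * (K ^ 2 / m) ^ 2) ∂P := by
          refine integral_mono hY'L.integrable_sq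
            ((hYL.integrable_sq.const_mul 2).add (integrable_const _)) fun ω => ?_
          simp only [hY']
          nlinarith [sq_nonneg (Y ω - K ^ 2 / m)]
      _ = 2 * ∫ ω, Y ω ^ 2 ∂P + 2 * (K ^ 2 / m) ^ 2 := by
          rw [integral_add (hYL.integrable_sq.const_mul 2) (integrable_const _),
            integral_const_mul]
          simp
      _ ≤ 2 * (4 * κ * K ^ 2 * G σ 1 / m) + 2 * ((K ^ 2) ^ 2 / m) := by
          have : (K ^ 2 / m) ^ 2 ≤ (K ^ 2) ^ 2 / m := by
            rw [div_pow]
            exact div_le_div_of_nonneg_left (sq_nonneg _) hm0' (by nlinarith)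
          linarith
      _ = C₁ / m := by rw [hC₁]; ring
  have hZint : ∫ ω, Z ω ^ 2 ∂P ≤ C₂ := by
    have hi1 : Integrable (fun ω => (1 + L) ^ 2 + Real.log (S n₀ ω) ^ 2) P :=
      (integrable_const _).add hAL.integrable_sq
    calc ∫ ω, Z ω ^ 2 ∂P
        ≤ ∫ ω, 3 * ((1 + L) ^ 2 + Real.log (S n₀ ω) ^ 2 + Real.log (S m ω) ^ 2) ∂P := by
          refine integral_mono hZL.integrable_sq ((hi1.add hBL.integrable_sq).const_mul 3)
            fun ω => ?_
          simp only [hZ]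
          rw [← sq_abs (Real.log (S n₀ ω)), ← sq_abs (Real.log (S m ω))]
          nlinarith [sq_nonneg ((1 + L) - |Real.log (S n₀ ω)|),
            sq_nonneg ((1 + L) - |Real.log (S m ω)|),
            sq_nonneg (|Real.log (S n₀ ω)| - |Real.log (S m ω)|)]
      _ = 3 * ((1 + L) ^ 2 + ∫ ω, Real.log (S n₀ ω) ^ 2 ∂P
            + ∫ ω, Real.log (S m ω) ^ 2 ∂P) := by
          rw [integral_const_mul, integral_add hi1 hBL.integrable_sq,
            integral_add (integrable_const _) hAL.integrable_sq]
          simp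
      _ ≤ C₂ := by
          rw [hC₂]
          gcongr
  refine ⟨fun ω => Y' ω / c * Z ω, ?_, ?_, ?_⟩
  · have := (hY'L.integrable_mul hZL).const_mul c⁻¹
    refine this.congr (Eventually.of_forall fun ω => ?_)
    simp only [Pi.mul_apply]
    ring
  · set r := √(1 / (m : ℝ)) with hr
    have hr0 : 0 < r := Real.sqrt_pos.2 (by positivity)
    have hr2 : r ^ 2 = 1 / m := Real.sq_sqrt (by positivity)
    -- Young's inequality with the weight `r = Δ^{1/2}` replaces the Cauchy-Schwarz inequality.
    calc ∫ ω, Y' ω / c * Z ω ∂P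
        ≤ ∫ ω, (1 / (2 * c * r) * Y' ω ^ 2 + r / (2 * c) * Z ω ^ 2) ∂P := by
          refine integral_mono ?_ ((hY'L.integrable_sq.const_mul _).add
            (hZL.integrable_sq.const_mul _)) fun ω => ?_
          · refine ((hY'L.integrable_mul hZL).const_mul c⁻¹).congr
              (Eventually.of_forall fun ω => ?_)
            simp only [Pi.mul_apply]
            ring
          · simp only []
            have : 1 / (2 * c * r) * Y' ω ^ 2 + r / (2 * c) * Z ω ^ 2 - Y' ω / c * Z ω
                = (Y' ω - r * Z ω) ^ 2 / (2 * c * r) := by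
              field_simp; ring
            have h2 : 0 ≤ (Y' ω - r * Z ω) ^ 2 / (2 * c * r) := by positivity
            linarith
      _ = 1 / (2 * c * r) * ∫ ω, Y' ω ^ 2 ∂P + r / (2 * c) * ∫ ω, Z ω ^ 2 ∂P := by
          rw [integral_add (hY'L.integrable_sq.const_mul _) (hZL.integrable_sq.const_mul _),
            integral_const_mul, integral_const_mul]
      _ ≤ 1 / (2 * c * r) * (C₁ * r ^ 2) + r / (2 * c) * C₂ := by
          rw [hr2, mul_one_div]
          gcongr
      _ = (C₁ + C₂) / (2 * c) * r := by field_simp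
  · obtain ⟨-, hlaw⟩ := hσ.iIndepFun_increments hm0 hB hI
    filter_upwards [ae_ne_zero_of_hasLaw_gaussianReal (hσ.G_increment_pos hm0) (hlaw 0 hm0)]
      with ω hω t ht
    have ht1 : t ∈ Icc (0 : ℝ) 1 := ⟨hα.1.le.trans ht.1, ht.2⟩
    rw [sum_range_ite_gridPt_le hm0 ht1]
    obtain ⟨hn1, hn2, hn3, hn4⟩ := hfloor t ht
    set n := ⌊t * m⌋₊
    have hSmono : ∀ {i j : ℕ}, i ≤ j → S i ω ≤ S j ω := fun {i j} hij =>
      Finset.sum_le_sum_of_subset_of_nonneg (Finset.range_mono hij) fun k _ _ => sq_nonneg _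
    have hSpos : 0 < S n₀ ω := by
      refine lt_of_lt_of_le ?_ (hSmono hn₀pos)
      simp only [hS, Finset.sum_range_one]
      positivity
    refine ⟨hSpos.trans_le (hSmono hn2), ?_⟩
    refine abs_log_sub_log_le hc0 hSpos ⟨hSmono hn2, hSmono hn1⟩ ⟨?_, ?_⟩ ?_
    · rw [hc, mul_div_cancel₀ _ two_ne_zero]
      exact hσ.G_strictMonoOn.monotoneOn hα1 ht1 ht.1
    · exact hσ.G_strictMonoOn.monotoneOn ht1 (by simp) ht.2
    · have h1 := hY ω n hn1
      have h2 := hσ.G_sub_le (natCast_div_mem_Icc hn1) ht1 hn3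
      have h3 := hσ.G_strictMonoOn.monotoneOn (natCast_div_mem_Icc hn1) ht1 hn3
      have h4 : K ^ 2 * (t - (n : ℝ) / m) ≤ K ^ 2 / m := by
        rw [div_eq_mul_one_div (K ^ 2)]
        exact mul_le_mul_of_nonneg_left (by linarith) (sq_nonneg _)
      rw [abs_le] at h1 ⊢
      simp only [hY']
      constructor <;> linarith [h1.1, h1.2]

end IsVolatility

end FSV

/-! ### From a majorant to orders of magnitude -/

namespace FSV

/-- Since `R i = g i * ∫ σ dW i`, taking logarithms separates the factor `g i` from the realized
volatility of the Itô integral. -/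
lemma log_Qhat_eq {Ω : Type*} {R : ℤ → ℝ≥0 → Ω → ℝ} {m : ℕ} {i : ℤ} {t : ℝ} {ω : Ω}
    {γ : ℝ} {x : ℕ → ℝ}
    (hγ : 0 < γ) (hR : ∀ k ≤ m, R i (gridPt m k) ω = γ * x k)
    (hpos : 0 < ∑ k ∈ Finset.range m,
      (if (gridPt m (k + 1) : ℝ) ≤ t then (x (k + 1) - x k) ^ 2 else 0)) :
    Real.log (Qhat R m i t ω) = 2 * Real.log γ + Real.log (∑ k ∈ Finset.range m,
      (if (gridPt m (k + 1) : ℝ) ≤ t then (x (k + 1) - x k) ^ 2 else 0)) := by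
  have hQ : Qhat R m i t ω = γ ^ 2 * ∑ k ∈ Finset.range m,
      (if (gridPt m (k + 1) : ℝ) ≤ t then (x (k + 1) - x k) ^ 2 else 0) := by
    rw [Qhat, Finset.mul_sum]
    refine Finset.sum_congr rfl fun k hk => ?_
    have hk := Finset.mem_range.1 hk
    rw [hR k hk.le, hR (k + 1) hk, sq_abs]
    split_ifs <;> ring
  rw [hQ, Real.log_mul (by positivity) hpos.ne', Real.log_pow]
  push_cast
  ring

variable {Ω : Type*} [MeasurableSpace Ω] {P : Measure Ω} [IsProbabilityMeasure P]

lemma rate_eq (N m : ℕ) : rate N m = 1 / √N + √(1 / m) := by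
  rw [rate, Real.sqrt_eq_rpow (1 / (m : ℝ)), Real.rpow_neg (Nat.cast_nonneg _), Real.sqrt_eq_rpow,
    one_div ((N : ℝ) ^ (1 / 2 : ℝ))]

lemma rate_pos {N : ℕ} (hN : 0 < N) (m : ℕ) : 0 < rate N m := by
  have : (0 : ℝ) < N := by exact_mod_cast hN
  rw [rate_eq]; positivity

lemma tendsto_rate : Tendsto (fun p : ℕ × ℕ => rate p.1 p.2) (atTop ×ˢ atTop) (𝓝 0) := by
  have h1 : Tendsto (fun N : ℕ => 1 / √(N : ℝ)) atTop (𝓝 0) := by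
    simp only [one_div]
    exact (Real.tendsto_sqrt_atTop.comp tendsto_natCast_atTop_atTop).inv_tendsto_atTop
  have h2 : Tendsto (fun m : ℕ => √(1 / (m : ℝ))) atTop (𝓝 0) := by
    have := (Real.continuous_sqrt.tendsto 0).comp tendsto_one_div_atTop_nhds_zero_nat
    simpa [Function.comp_def] using this
  simp only [rate_eq]
  simpa using (h1.comp tendsto_fst).add (h2.comp tendsto_snd)

lemma ofReal_iSup_le {α c : ℝ} {f : ℝ → ℝ} (h : ∀ t ∈ Icc α 1, f t ≤ c) :
    ⨆ t ∈ Icc α 1, ENNReal.ofReal (f t) ≤ ENNReal.ofReal c :=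
  iSup₂_le fun t ht => ENNReal.ofReal_le_ofReal (h t ht)

lemma abs_exp_sub_exp_le {a b d q : ℝ} (hd : |a - b| ≤ d) (hd1 : d ≤ 1) (hq : Real.exp b ≤ q) :
    |Real.exp a - Real.exp b| ≤ 2 * q * d := by
  have h1 := Real.abs_exp_sub_one_le (hd.trans hd1)
  have h2 : Real.exp a - Real.exp b = Real.exp b * (Real.exp (a - b) - 1) := by
    rw [mul_sub, ← Real.exp_add]; simp
  rw [h2, abs_mul, abs_of_pos (Real.exp_pos b)]
  calc Real.exp b * |Real.exp (a - b) - 1| ≤ q * (2 * d) := by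
        refine mul_le_mul hq (by linarith) (abs_nonneg _) ((Real.exp_pos b).le.trans hq)
    _ = 2 * q * d := by ring

/-- Integrable majorants with mean `O(rate)` of the deviation of `Ĥ` from `H` give both orders of
magnitude; for `Ĝ = exp Ĥ`, Markov's inequality is applied to the majorant twice, once to reduce
to deviations at most `1`. -/
lemma orders_of_majorant {R : ℤ → ℝ≥0 → Ω → ℝ} {σ : ℝ → ℝ} {α q C : ℝ} {m₀ : ℕ} (hq : 0 < q)
    (hG : ∀ t ∈ Icc α 1, G σ t ∈ Ioc 0 q)
    (hmaj : ∀ N m, 1 ≤ N → m₀ ≤ m → ∃ Z : Ω → ℝ, Integrable Z P ∧ ∫ ω, Z ω ∂P ≤ C * rate N m ∧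
      ∀ᵐ ω ∂P, 0 ≤ Z ω ∧ ∀ t ∈ Icc α 1, |Hhat R N m t ω - H σ t| ≤ Z ω) :
    MeanIsBigO P (fun N m ω => ⨆ t ∈ Icc α 1, ENNReal.ofReal |Hhat R N m t ω - H σ t|) rate ∧
    IsBigOInProb P (fun N m ω => ⨆ t ∈ Icc α 1, ENNReal.ofReal |Ghat R N m t ω - G σ t|)
      rate := by
  have hev : ∀ᶠ p : ℕ × ℕ in atTop ×ˢ atTop, 1 ≤ p.1 ∧ m₀ ≤ p.2 :=
    ((eventually_ge_atTop 1).prod_inl _).and ((eventually_ge_atTop m₀).prod_inr _)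
  constructor
  · refine ⟨C, hev.mono fun p hp => ?_⟩
    obtain ⟨Z, hZ, hZC, hZω⟩ := hmaj p.1 p.2 hp.1 hp.2
    -- The supremum need not be measurable; the upper integral is monotone all the same.
    calc _ ≤ ∫⁻ ω, ENNReal.ofReal (Z ω) ∂P := by
          refine lintegral_mono_ae ?_
          filter_upwards [hZω] with ω hω
          exact ofReal_iSup_le hω.2
      _ = ENNReal.ofReal (∫ ω, Z ω ∂P) :=
          (ofReal_integral_eq_lintegral_ofReal hZ (hZω.mono fun ω h => h.1)).symm
      _ ≤ _ := ENNReal.ofReal_le_ofReal hZC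
  · intro δ hδ
    set D := |C| + 1 with hD
    have hD0 : 0 < D := by positivity
    have hDC : C ≤ D := (le_abs_self C).trans (by linarith)
    refine ⟨2 * q * (2 * D / δ), ?_⟩
    have hsmall : ∀ᶠ p : ℕ × ℕ in atTop ×ˢ atTop, rate p.1 p.2 < δ / (2 * D) :=
      (tendsto_order.1 tendsto_rate).2 _ (by positivity)
    filter_upwards [hev, hsmall] with p hp hrate
    obtain ⟨Z, hZ, hZC, hZω⟩ := hmaj p.1 p.2 hp.1 hp.2
    have hr := rate_pos hp.1 p.2
    set r := rate p.1 p.2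
    have hZ0 : 0 ≤ᵐ[P] Z := hZω.mono fun ω h => h.1
    -- Markov's inequality for the majorant.
    have hmarkov : ∀ x : ℝ, 0 < x → D * r / x ≤ δ / 2 →
        P {ω | x ≤ Z ω} ≤ ENNReal.ofReal (δ / 2) := fun x hx hxδ => by
      have h1 := mul_meas_ge_le_integral_of_nonneg hZ0 hZ x
      rw [← ofReal_measureReal]
      refine ENNReal.ofReal_le_ofReal (le_trans ?_ hxδ)
      rw [le_div_iff₀ hx, mul_comm]
      exact h1.trans (hZC.trans (mul_le_mul_of_nonneg_right hDC hr.le))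
    have hset : {ω | ENNReal.ofReal (2 * q * (2 * D / δ) * r) <
          ⨆ t ∈ Icc α 1, ENNReal.ofReal |Ghat R p.1 p.2 t ω - G σ t|}
        ≤ᵐ[P] ({ω | 1 ≤ Z ω} ∪ {ω | 2 * D / δ * r ≤ Z ω} : Set Ω) := by
      filter_upwards [hZω] with ω hω hmem
      by_contra hnot
      have h1 : ¬ 1 ≤ Z ω := fun h => hnot (Or.inl h)
      have h2 : ¬ 2 * D / δ * r ≤ Z ω := fun h => hnot (Or.inr h)
      push Not at h1 h2
      refine absurd hmem (not_lt.2 ?_)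
      refine ofReal_iSup_le fun t ht => ?_
      have hGt := hG t ht
      have hexp : G σ t = Real.exp (H σ t) := by rw [H, Real.exp_log hGt.1]
      have h3 := abs_exp_sub_exp_le (hω.2 t ht) h1.le (hexp ▸ hGt.2)
      rw [← hexp] at h3
      refine h3.trans ?_
      rw [mul_assoc (2 * q)]
      exact mul_le_mul_of_nonneg_left h2.le (by positivity)
    calc _ ≤ P ({ω | 1 ≤ Z ω} ∪ {ω | 2 * D / δ * r ≤ Z ω}) := measure_mono_ae hset
      _ ≤ P {ω | 1 ≤ Z ω} + P {ω | 2 * D / δ * r ≤ Z ω} := measure_union_le _ _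
      _ ≤ ENNReal.ofReal (δ / 2) + ENNReal.ofReal (δ / 2) := by
          refine add_le_add (hmarkov _ one_pos ?_) (hmarkov _ (by positivity) ?_)
          · rw [div_one]
            rw [lt_div_iff₀ (by positivity)] at hrate
            linarith
          · refine le_of_eq ?_
            field_simp
      _ = ENNReal.ofReal δ := by
          rw [← ENNReal.ofReal_add (by positivity) (by positivity), add_halves]

end FSV

theorem mainTheorem7 {Ω : Type*} [MeasurableSpace Ω] (P : Measure Ω) [IsProbabilityMeasure P]
    (σ : ℝ → ℝ) (φ v : ℝ) (W : ℤ → ℝ≥0 → Ω → ℝ) (ε g : ℤ → Ω → ℝ) (R : ℤ → ℝ≥0 → Ω → ℝ)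
    (hmodel : FSV.IsModel P σ φ v W ε g R)
    (hσ_meas : Measurable ((Set.Icc (0 : ℝ) 1).domRestrict σ))
    (hσ_nonneg : ∀ t ∈ Set.Icc (0 : ℝ) 1, 0 ≤ σ t)
    (hσ_bdd : BddAbove (σ '' Set.Icc (0 : ℝ) 1))
    (hg_pos : ∀ i : ℤ, ∀ᵐ ω ∂P, 0 < g i ω)
    (hW_brownian : ∀ i : ℤ, IsBrownianReal (W i) P)
    (hW_indep : iIndepFun (fun (i : ℤ) ω (t : ℝ≥0) => W i t ω) P)
    (hWg_indep : IndepFun (fun ω (i : ℤ) (t : ℝ≥0) => W i t ω) (fun ω (i : ℤ) => g i ω) P)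
    (hφ : |φ| < 1)
    (hσ_ne : ∀ᵐ t ∂(volume.restrict (Set.Icc (0 : ℝ) 1)), σ t ≠ 0)
    (α : ℝ) (hα : α ∈ Set.Ioo (0 : ℝ) 1) :
    FSV.MeanIsBigO P
      (fun N m ω => ⨆ t ∈ Set.Icc α 1, ENNReal.ofReal |FSV.Hhat R N m t ω - FSV.H σ t|)
      FSV.rate ∧
    FSV.IsBigOInProb P
      (fun N m ω => ⨆ t ∈ Set.Icc α 1, ENNReal.ofReal |FSV.Ghat R N m t ω - FSV.G σ t|)
      FSV.rate := by
  obtain ⟨K, hK⟩ := hσ_bdd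
  have hσ : FSV.IsVolatility σ K :=
    ⟨hσ_meas, hσ_nonneg, fun t ht => hK (mem_image_of_mem σ ht), hσ_ne⟩
  -- The log-volatility factors form a stationary autoregression.
  have hst : ∀ i, IdentDistrib (fun ω => Real.log (g i ω)) (fun ω => Real.log (g 0 ω)) P P :=
    fun i => by
      have h := (hmodel.stationary i).comp (u := fun x : ℤ → ℝ => Real.log (x 0))
        (Real.measurable_log.comp (measurable_pi_apply 0))
      simpa [Function.comp_def] using h
  obtain ⟨hgi, A, hA0, hA⟩ := exists_integral_abs_sum_autoregression_le
    (X := fun i ω => Real.log (g i ω)) hφ hmodel.eq_g hmodel.noise_indep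
    hmodel.noise_identDistrib hmodel.noise_memLp hmodel.noise_mean hst
  obtain ⟨C, hC⟩ := hσ.exists_majorant (P := P) hα
  have hα' : ∀ t ∈ Icc α 1, t ∈ Icc (0 : ℝ) 1 := fun t ht => ⟨hα.1.le.trans ht.1, ht.2⟩
  refine FSV.orders_of_majorant (q := FSV.G σ 1) (C := 2 * A + |C|) (m₀ := ⌈2 / α⌉₊)
    (hσ.G_pos ⟨one_pos, le_rfl⟩)
    (fun t ht => ⟨hσ.G_pos ⟨hα.1.trans_le ht.1, ht.2⟩,
      hσ.G_strictMonoOn.monotoneOn (hα' t ht) (by simp) ht.2⟩) fun N m hN hm => ?_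
  have hN0 : (0 : ℝ) < N := by exact_mod_cast hN
  have hgrid : ∀ k ≤ m, FSV.gridPt m k ≤ 1 := fun k hk => by
    rw [← NNReal.coe_le_coe, FSV.coe_gridPt, NNReal.coe_one]
    exact (FSV.natCast_div_mem_Icc hk).2
  -- The Itô integrals at the design points, for each `i`.
  have hIex : ∀ i : ℤ, ∀ k : ℕ, ∃ I : Ω → ℝ, k ≤ m →
      FSV.IsItoIntegral P (W i) σ (FSV.gridPt m k) I ∧
      ∀ᵐ ω ∂P, R i (FSV.gridPt m k) ω = g i ω * I ω := fun i k => by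
    by_cases hk : k ≤ m
    · obtain ⟨I, hI⟩ := hmodel.eq_R i _ (hgrid k hk)
      exact ⟨I, fun _ => hI⟩
    · exact ⟨0, fun h => absurd h hk⟩
  choose I hI using hIex
  choose U hUi hUC hU using fun i => hC m ((Nat.le_ceil _).trans (by exact_mod_cast hm))
    (hW_brownian i).toIsPreBrownianReal (I := I i) (fun k hk => (hI i k hk).1)
  have hgsum : Integrable (fun ω => ∑ i ∈ Finset.Icc 1 N, Real.log (g (i : ℤ) ω)) P :=
    integrable_finsetSum _ fun i _ => hgi _
  have hUsum : Integrable (fun ω => ∑ i ∈ Finset.Icc 1 N, U (i : ℤ) ω) P :=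
    integrable_finsetSum _ fun i _ => hUi _
  refine ⟨fun ω => 2 / N * |∑ i ∈ Finset.Icc 1 N, Real.log (g (i : ℤ) ω)|
      + 1 / N * ∑ i ∈ Finset.Icc 1 N, U (i : ℤ) ω,
    (hgsum.abs.const_mul _).add (hUsum.const_mul _), ?_, ?_⟩
  · rw [integral_add (hgsum.abs.const_mul _) (hUsum.const_mul _), integral_const_mul,
      integral_const_mul, integral_finsetSum _ fun i _ => hUi _, FSV.rate_eq]
    have h1 : ∑ i ∈ Finset.Icc 1 N, ∫ ω, U (i : ℤ) ω ∂P ≤ N * (|C| * √(1 / m)) := by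
      have : ∀ i ∈ Finset.Icc 1 N, ∫ ω, U (i : ℤ) ω ∂P ≤ |C| * √(1 / m) := fun i _ =>
        (hUC i).trans (mul_le_mul_of_nonneg_right (le_abs_self C) (Real.sqrt_nonneg _))
      simpa using Finset.sum_le_card_nsmul _ _ _ this
    have hsq : √(N : ℝ) * √N = N := Real.mul_self_sqrt hN0.le
    have hs0 : 0 < √(N : ℝ) := Real.sqrt_pos.2 hN0
    calc _ ≤ 2 / N * (A * √N) + 1 / N * (N * (|C| * √(1 / m))) := by
          gcongr
          exact hA N hN
      _ = 2 * A * (1 / √N) + |C| * √(1 / m) := by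
          have h2 : 2 / (N : ℝ) * (A * √N) = 2 * A * (1 / √N) := by
            rw [div_mul_eq_mul_div, mul_one_div, div_eq_div_iff hN0.ne' hs0.ne']
            linear_combination 2 * A * hsq
          rw [h2]; field_simp
      _ ≤ (2 * A + |C|) * (1 / √N + √(1 / m)) := by
          have h3 : 0 ≤ |C| * (1 / √N) := by positivity
          have h4 : 0 ≤ 2 * A * √(1 / (m : ℝ)) := by positivity
          nlinarith
  · have hRI : ∀ᵐ ω ∂P, ∀ i : ℤ, ∀ k ≤ m, R i (FSV.gridPt m k) ω = g i ω * I i k ω := by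
      refine ae_all_iff.2 fun i => ae_all_iff.2 fun k => ?_
      by_cases hk : k ≤ m
      · exact ((hI i k hk).2).mono fun ω h _ => h
      · exact Eventually.of_forall fun ω h => absurd h hk
    filter_upwards [hRI, ae_all_iff.2 hg_pos, ae_all_iff.2 hU] with ω hR hg hUω
    have hmain : ∀ t ∈ Icc α 1, |FSV.Hhat R N m t ω - FSV.H σ t| ≤
        2 / N * |∑ i ∈ Finset.Icc 1 N, Real.log (g (i : ℤ) ω)|
          + 1 / N * ∑ i ∈ Finset.Icc 1 N, U (i : ℤ) ω := fun t ht => by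
      have hlog : ∀ i : ℤ, Real.log (FSV.Qhat R m i t ω) - FSV.H σ t = 2 * Real.log (g i ω) +
          (Real.log (∑ k ∈ Finset.range m, (if (FSV.gridPt m (k + 1) : ℝ) ≤ t then
            (I i (k + 1) ω - I i k ω) ^ 2 else 0)) - FSV.H σ t) := fun i => by
        rw [FSV.log_Qhat_eq (x := fun k => I i k ω) (hg i) (hR i) (hUω i t ht).1]
        ring
      have hsplit : FSV.Hhat R N m t ω - FSV.H σ t =
          2 / N * ∑ i ∈ Finset.Icc 1 N, Real.log (g (i : ℤ) ω) + 1 / N *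
          ∑ i ∈ Finset.Icc 1 N, (Real.log (∑ k ∈ Finset.range m,
            (if (FSV.gridPt m (k + 1) : ℝ) ≤ t then
              (I (i : ℤ) (k + 1) ω - I (i : ℤ) k ω) ^ 2 else 0)) - FSV.H σ t) := by
        have h1 : FSV.Hhat R N m t ω - FSV.H σ t = 1 / N * ∑ i ∈ Finset.Icc 1 N,
            (Real.log (FSV.Qhat R m (i : ℤ) t ω) - FSV.H σ t) := by
          rw [FSV.Hhat, Finset.sum_sub_distrib, mul_sub]
          simp only [Finset.sum_const, Nat.card_Icc, add_tsub_cancel_right, nsmul_eq_mul]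
          field_simp
        rw [h1, Finset.sum_congr rfl fun (i : ℕ) _ => hlog i, Finset.sum_add_distrib,
          ← Finset.mul_sum]
        ring
      rw [hsplit]
      refine (abs_add_le _ _).trans (add_le_add ?_ ?_)
      · rw [abs_mul, abs_of_nonneg (by positivity : (0 : ℝ) ≤ 2 / N)]
      · rw [abs_mul, abs_of_nonneg (by positivity : (0 : ℝ) ≤ 1 / N)]
        refine mul_le_mul_of_nonneg_left ?_ (by positivity)
        exact (Finset.abs_sum_le_sum_abs _ _).trans
          (Finset.sum_le_sum fun i _ => (hUω i t ht).2)
    exact ⟨(abs_nonneg _).trans (hmain 1 ⟨hα.2.le, le_rfl⟩), hmain⟩
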